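/- Let $n\ge 3$, $R<0$ and $a>0$. Let $(M,g)$ be the complete spatial AdS-Schwarzschild manifold of dimension $n$, of scalar curvature $R$ and positive mass parameter $a$: $M=\mathbb R\times\mathbb S^{n-1}$ and $g=ds^2+r(s)^2h$, where $h$ is the round metric of the unit sphere and $r:\mathbb R\to(0,\infty)$ is smooth with $$ (r')^2 = 1-\frac{R}{n(n-1)}\,r^2-\frac{2a}{n-2}\,r^{2-n},\qquad r'>0 \text{ on } (0,\infty),\quad r'<0\text{ on }(-\infty,0), $$ so that $g=\bigl(1-\frac{R}{n(n-1)}r^2-\frac{2a}{n-2}r^{2-n}\bigr)^{-1}dr^2+r^2h$ on each of the two components $M_+=\{s>0\}$ and $M_-=\{s<0\}$ of the complement of the horizon $\Sigma_0=\{0\}\times\mathbb S^{n-1}$. Write $\Sigma_t=\{t\}\times\mathbb S^{n-1}$ for the rotationally symmetric spheres; $\Sigma_{-t}$ is the reflection of $\Sigma_t$ with respect to $\Sigma_0$. Consider the equation $$ -(\Delta_g\lambda)\,g+\nabla^2_g\lambda-\lambda\,\mathrm{Ric}(g)=g. \qquad (*)$$ A metric on a compact manifold with smooth boundary is called *critical*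 if there is a smooth function $\lambda$ (smooth up to the boundary) that satisfies $(*)$ and vanishes on the boundary. Then: (i) There exists a smooth function $\lambda$ on $M$ that satisfies $(*)$ on $(M,g)$. (ii) There exists $\zeta>0$ such that, if $U=[-\zeta,\zeta]\times\mathbb S^{n-1}$ is the closed domain bounded by $\Sigma_\zeta$ and $\Sigma_{-\zeta}$, then for every rotationally symmetric sphere $\Sigma_{\zeta_1}\subset M_+\setminus U$ there is a rotationally symmetric sphere $\Sigma_{\zeta_2}\subset M_-\setminus U$ such that $g$ is a critical metric on the closed domain $[\zeta_2,\zeta_1]\times\mathbb S^{n-1}$ bounded by $\Sigma_{\zeta_1}$ and $\Sigma_{\zeta_2}$; and the same holds with the roles of $M_+$ and $M_-$ interchanged. (iii) With $U$ as in (ii), there exists $\theta>\zeta$, so that $\Sigma_\theta\subset M_+\setminus U$ and $\Sigma_{-\theta}\subset M_-\setminus U$, with the following property. Let $\Omega$ be the closed domain bounded by $\Sigma_\theta$ and $\Sigma_0$, or the closed domain bounded by $\Sigma_{-\theta}$ and $\Sigma_0$, and let $(\tilde\Omega,\tilde g)$ be the quotient manifold obtained from $(\Omega,g)$ by identifying points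 of $\Sigma_0$ through the antipodal map of $\Sigma_0$; equivalently, $\tilde\Omega$ is the image of $\Omega$ in the quotient of $(M,g)$ by the free isometric involution $(s,x)\mapsto(-s,-x)$, with the induced metric. Then $\tilde g$ is a critical metric on $\tilde\Omega$. -/

import Mathlib

open Metric Set Module
open scoped Manifold ContDiff Topology

noncomputable section

/-! ## Riemannian geometry in coordinates

`G : V → V →L[ℝ] V →L[ℝ] ℝ` is the coordinate expression of a Riemannian metric, a field of
bilinear forms on a finite-dimensional vector space `V`. -/

namespace RiemCoord

variable {V : Type*} [NormedAddCommGroup V] [NormedSpace ℝ V]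

set_option maxSynthPendingDepth 6 in
/-- Christoffel symbols of the first kind:
`Γ(v, w; z) = ½ (∂_v G(w, z) + ∂_w G(v, z) - ∂_z G(v, w))`. -/
def christoffelFirst (G : V → V →L[ℝ] V →L[ℝ] ℝ) (y : V) : V →L[ℝ] V →L[ℝ] V →L[ℝ] ℝ :=
  let D : V →L[ℝ] V →L[ℝ] V →L[ℝ] ℝ := fderiv ℝ G y
  let flip₂ : (V →L[ℝ] V →L[ℝ] ℝ) →L[ℝ] V →L[ℝ] V →L[ℝ] ℝ :=
    (ContinuousLinearMap.flipₗᵢ ℝ V V ℝ).toContinuousLinearEquiv.toContinuousLinearMap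
  let D' : V →L[ℝ] V →L[ℝ] V →L[ℝ] ℝ := D.flip
  let D'' : V →L[ℝ] V →L[ℝ] V →L[ℝ] ℝ := flip₂ ∘L D'
  (1 / 2 : ℝ) • (D + D' - D'')

set_option maxSynthPendingDepth 6 in
theorem christoffelFirst_apply (G : V → V →L[ℝ] V →L[ℝ] ℝ) (y v w z : V) :
    christoffelFirst G y v w z =
      1 / 2 * (fderiv ℝ G y v w z + fderiv ℝ G y w v z - fderiv ℝ G y z v w) := by
  simp [christoffelFirst]

/-- Christoffel symbols `Γ(v, w)` of the Levi-Civita connection: the index is raised with the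
inverse of the metric `G y : V → V*`. -/
def christoffel (G : V → V →L[ℝ] V →L[ℝ] ℝ) (y : V) : V →L[ℝ] V →L[ℝ] V :=
  (ContinuousLinearMap.compL ℝ V (V →L[ℝ] ℝ) V (G y).inverse) ∘L christoffelFirst G y

theorem christoffel_apply (G : V → V →L[ℝ] V →L[ℝ] ℝ) (y v w : V) :
    christoffel G y v w = (G y).inverse (christoffelFirst G y v w) := by
  simp [christoffel]

/-- Riemann curvature
`R(u, v) w = ∂_u Γ(v, w) - ∂_v Γ(u, w) + Γ(u, Γ(v, w)) - Γ(v, Γ(u, w))`. -/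
def curvature (G : V → V →L[ℝ] V →L[ℝ] ℝ) (y u v w : V) : V :=
  fderiv ℝ (christoffel G) y u v w - fderiv ℝ (christoffel G) y v u w
    + christoffel G y u (christoffel G y v w) - christoffel G y v (christoffel G y u w)

/-- Ricci curvature: `Ric(v, w)` is the trace of `u ↦ R(u, v) w`. -/
def ricci (G : V → V →L[ℝ] V →L[ℝ] ℝ) (y v w : V) : ℝ :=
  LinearMap.trace ℝ V
    { toFun := fun u => curvature G y u v w
      map_add' := fun u u' => by simp only [curvature, map_add, add_apply]; abel
      map_smul' := fun c u => by
        simp only [curvature, map_smul, smul_apply, RingHom.id_apply]; module }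

/-- Hessian `∇²f(v, w) = ∂²f(v, w) - ∂f(Γ(v, w))`. -/
def hessian (G : V → V →L[ℝ] V →L[ℝ] ℝ) (f : V → ℝ) (y : V) : V →L[ℝ] V →L[ℝ] ℝ :=
  fderiv ℝ (fderiv ℝ f) y -
    (ContinuousLinearMap.compL ℝ V V ℝ (fderiv ℝ f y)) ∘L christoffel G y

theorem hessian_apply (G : V → V →L[ℝ] V →L[ℝ] ℝ) (f : V → ℝ) (y v w : V) :
    hessian G f y v w = fderiv ℝ (fderiv ℝ f) y v w - fderiv ℝ f y (christoffel G y v w) := by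
  simp [hessian]

/-- Laplacian: the trace of the Hessian with respect to the metric. -/
def laplacian (G : V → V →L[ℝ] V →L[ℝ] ℝ) (f : V → ℝ) (y : V) : ℝ :=
  LinearMap.trace ℝ V ((G y).inverse ∘L hessian G f y : V →L[ℝ] V)

end RiemCoord

/-! ## Riemannian geometry on a manifold (without boundary)

The tangent space at `p` is identified with the model vector space through the preferred chart at
`p`, as in Mathlib; Hessian, Laplacian and Ricci curvature at `p` are computed in that chart. -/

namespace RiemMfd

variable {V : Type*} [NormedAddCommGroup V] [NormedSpace ℝ V]
  {H : Type*} [TopologicalSpace H] (I : ModelWithCorners ℝ V H)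
  {M : Type*} [TopologicalSpace M] [ChartedSpace H M]

/-- The metric `g` in the preferred chart `φ` at `p`: at a point `y` of the model space, it is
`g_{φ⁻¹(y)}(dφ⁻¹ ·, dφ⁻¹ ·)`. -/
def coordMetric (g : ∀ q : M, TangentSpace I q →L[ℝ] TangentSpace I q →L[ℝ] ℝ) (p : M) :
    V → V →L[ℝ] V →L[ℝ] ℝ := fun y =>
  let B : V →L[ℝ] V →L[ℝ] ℝ := g ((extChartAt I p).symm y)
  let D : V →L[ℝ] V := mfderiv 𝓘(ℝ, V) I (extChartAt I p).symm y
  B.bilinearComp D D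

/-- The Ricci tensor of `g` at `p`. -/
def ricci (g : ∀ q : M, TangentSpace I q →L[ℝ] TangentSpace I q →L[ℝ] ℝ) (p : M)
    (v w : TangentSpace I p) : ℝ :=
  RiemCoord.ricci (coordMetric I g p) (extChartAt I p p) v w

/-- The Hessian `∇²f` with respect to `g` at `p`. -/
def hessian (g : ∀ q : M, TangentSpace I q →L[ℝ] TangentSpace I q →L[ℝ] ℝ) (f : M → ℝ) (p : M)
    (v w : TangentSpace I p) : ℝ :=
  RiemCoord.hessian (coordMetric I g p) (f ∘ (extChartAt I p).symm) (extChartAt I p p) v w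

/-- The Laplacian of `f` with respect to `g` at `p`. -/
def laplacian (g : ∀ q : M, TangentSpace I q →L[ℝ] TangentSpace I q →L[ℝ] ℝ) (f : M → ℝ)
    (p : M) : ℝ :=
  RiemCoord.laplacian (coordMetric I g p) (f ∘ (extChartAt I p).symm) (extChartAt I p p)

/-- The equation `-(Δ_g f) g + ∇²_g f - f Ric(g) = g` at the point `p`. -/
def CriticalEquationAt (g : ∀ q : M, TangentSpace I q →L[ℝ] TangentSpace I q →L[ℝ] ℝ)
    (f : M → ℝ) (p : M) : Prop :=
  ∀ v w : TangentSpace I p,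
    -(laplacian I g f p) * g p v w + hessian I g f p v w - f p * ricci I g p v w = g p v w

/-- `g` is a critical metric on the compact domain `D`: there is a function `f`, smooth up to the
boundary of `D` (that is, smooth in a neighbourhood of `D`), which satisfies
`-(Δ_g f) g + ∇²_g f - f Ric(g) = g` on `D` and vanishes on the boundary of `D`. -/
def IsCriticalOn (g : ∀ q : M, TangentSpace I q →L[ℝ] TangentSpace I q →L[ℝ] ℝ)
    (D : Set M) : Prop :=
  IsCompact D ∧ ∃ f : M → ℝ, (∀ p ∈ D, ContMDiffAt I 𝓘(ℝ, ℝ) ∞ f p) ∧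
    (∀ p ∈ D, CriticalEquationAt I g f p) ∧ ∀ p ∈ frontier D, f p = 0

end RiemMfd

/-! ## AdS-Schwarzschild manifolds -/

namespace AdS

/-- `1 - R / (n (n - 1)) ρ² - 2 a / (n - 2) ρ^(2 - n)`. In terms of the area radius `ρ`, the
AdS-Schwarzschild metric of scalar curvature `R < 0` and mass parameter `a` is
`dρ² / potential n R a ρ + ρ² h` with `h` the round metric of the unit sphere. -/
def potential (n : ℕ) (R a ρ : ℝ) : ℝ :=
  1 - R / ((n : ℝ) * ((n : ℝ) - 1)) * ρ ^ 2 - 2 * a / ((n : ℝ) - 2) * ρ ^ (2 - (n : ℤ))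

/-- `r` is the area radius of the complete `n`-dimensional AdS-Schwarzschild manifold
`(ℝ × 𝕊ⁿ⁻¹, ds² + r(s)² h)` as a function of the signed distance `s` to the horizon. On either side
of the horizon `r` is a coordinate with `dr² / potential n R a r = ds²`. -/
structure IsProfile (n : ℕ) (R a : ℝ) (r : ℝ → ℝ) : Prop where
  smooth : ContDiff ℝ ∞ r
  pos : ∀ s, 0 < r s
  deriv_sq : ∀ s, deriv r s ^ 2 = potential n R a (r s)
  deriv_pos : ∀ s, 0 < s → 0 < deriv r s
  deriv_neg : ∀ s, s < 0 → deriv r s < 0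

variable (d : ℕ)

/-- The manifold `ℝ × 𝕊ᵈ`, of dimension `d + 1`. -/
abbrev Space : Type := ℝ × sphere (0 : EuclideanSpace ℝ (Fin (d + 1))) 1

/-- The model with corners of `Space d` (there is no boundary). -/
abbrev model : ModelWithCorners ℝ (ℝ × EuclideanSpace ℝ (Fin d))
    (ModelProd ℝ (EuclideanSpace ℝ (Fin d))) := 𝓘(ℝ, ℝ).prod (𝓡 d)

/-- The warped product metric `ds² + r(s)² h` on `ℝ × 𝕊ᵈ`, where `h = ⟨dx, dx⟩` is the round metric
of the unit sphere, induced by the inclusion `x` into Euclidean space. -/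
def metric (r : ℝ → ℝ) (p : Space d) :
    TangentSpace (model d) p →L[ℝ] TangentSpace (model d) p →L[ℝ] ℝ :=
  let ds : ℝ × EuclideanSpace ℝ (Fin d) →L[ℝ] ℝ :=
    mvfderiv (model d) (fun q : Space d => q.1) p
  let dx : ℝ × EuclideanSpace ℝ (Fin d) →L[ℝ] EuclideanSpace ℝ (Fin (d + 1)) :=
    mvfderiv (model d) (fun q : Space d => (q.2 : EuclideanSpace ℝ (Fin (d + 1)))) p
  let ip : EuclideanSpace ℝ (Fin (d + 1)) →L[ℝ] EuclideanSpace ℝ (Fin (d + 1)) →L[ℝ] ℝ := innerSL ℝ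
  ((ContinuousLinearMap.mul ℝ ℝ).bilinearComp ds ds + r p.1 ^ 2 • ip.bilinearComp dx dx :
    ℝ × EuclideanSpace ℝ (Fin d) →L[ℝ] ℝ × EuclideanSpace ℝ (Fin d) →L[ℝ] ℝ)

theorem metric_apply (r : ℝ → ℝ) (p : Space d) (v w : TangentSpace (model d) p) :
    metric d r p v w =
      mvfderiv (model d) (fun q : Space d => q.1) p v *
        mvfderiv (model d) (fun q : Space d => q.1) p w +
      r p.1 ^ 2 * inner ℝ
        (mvfderiv (model d) (fun q : Space d => (q.2 : EuclideanSpace ℝ (Fin (d + 1)))) p v)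
        (mvfderiv (model d) (fun q : Space d => (q.2 : EuclideanSpace ℝ (Fin (d + 1)))) p w) :=
  rfl

/-- The closed domain bounded by the rotationally symmetric spheres `{s} × 𝕊ᵈ` and `{t} × 𝕊ᵈ`. -/
def region (s t : ℝ) : Set (Space d) := {p | p.1 ∈ Icc s t}

/-! ### The quotient by `(s, x) ↦ (-s, -x)` -/

/-- The action of `{1, -1}` on `ℝ × 𝕊ᵈ` in which `-1` acts by `(s, x) ↦ (-s, -x)`. -/
instance antipodalSMul : SMul ℤˣ (Space d) where
  smul u p := if u = 1 then p else (-p.1, -p.2)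

theorem neg_one_smul_eq (p : Space d) : (-1 : ℤˣ) • p = (-p.1, -p.2) := if_neg (by decide)

instance antipodalAction : MulAction ℤˣ (Space d) where
  one_smul p := if_pos rfl
  mul_smul u u' p := by
    rcases Int.units_eq_one_or u with rfl | rfl <;> rcases Int.units_eq_one_or u' with rfl | rfl <;>
      simp [HSMul.hSMul, SMul.smul]

instance : ContinuousConstSMul ℤˣ (Space d) where
  continuous_const_smul u := by
    rcases Int.units_eq_one_or u with rfl | rfl
    · exact continuous_id
    · exact (continuous_fst.neg.prodMk continuous_snd.neg :
        Continuous fun p : Space d => (-p.1, -p.2))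

instance : IsCancelSMul ℤˣ (Space d) where
  right_cancel' u u' p h := by
    have key : (-p.1, -p.2) ≠ p := fun h => by
      have h2 : -p.2 = p.2 := congrArg Prod.snd h
      exact ne_neg_of_mem_unit_sphere ℝ p.2 h2.symm
    rcases Int.units_eq_one_or u with rfl | rfl <;> rcases Int.units_eq_one_or u' with rfl | rfl
    · rfl
    · rw [neg_one_smul_eq, one_smul] at h; exact absurd h.symm key
    · rw [neg_one_smul_eq, one_smul] at h; exact absurd h key
    · rfl

/-- The quotient manifold of `ℝ × 𝕊ᵈ` by `(s, x) ~ (-s, -x)`, with the smooth structure for which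
the projection is a local diffeomorphism (its charts are the charts of `ℝ × 𝕊ᵈ` composed with local
inverses of the projection). -/
abbrev QuotSpace : Type := MulAction.orbitRel.Quotient ℤˣ (Space d)

/-- The projection onto the quotient. -/
def proj (p : Space d) : QuotSpace d := Quotient.mk _ p

/-- The projection identifies points `p ≠ q` of `[0, θ] × 𝕊ᵈ` exactly if they are antipodal points
of the horizon `{0} × 𝕊ᵈ`. -/
theorem proj_eq_proj_iff {θ : ℝ} {p q : Space d} (hp : p ∈ region d 0 θ) (hq : q ∈ region d 0 θ) :
    proj d p = proj d q ↔ p = q ∨ (p.1 = 0 ∧ q.1 = 0 ∧ p.2 = -q.2) := by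
  have hp1 : 0 ≤ p.1 := hp.1
  have hq1 : 0 ≤ q.1 := hq.1
  have : proj d p = proj d q ↔ ∃ u : ℤˣ, u • q = p := Quotient.eq''
  rw [this]
  constructor
  · rintro ⟨u, rfl⟩
    rcases Int.units_eq_one_or u with rfl | rfl
    · left; simp
    · right
      rw [neg_one_smul_eq] at hp1 ⊢
      have h0 : q.1 = 0 := by simp only at hp1; linarith
      simp [h0]
  · rintro (rfl | ⟨h1, h2, h3⟩)
    · exact ⟨1, one_smul _ _⟩
    · exact ⟨-1, by rw [neg_one_smul_eq]; ext1 <;> simp [h1, h2, h3]⟩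

/-- The metric induced on the quotient by the metric `ds² + r(s)² h`, that is, the metric for which
the projection is a local isometry: `g_p` transported by the differential of the projection at a
point `p` over `q`. (For even `r` the choice of `p` does not matter.) -/
def quotMetric (r : ℝ → ℝ) (q : QuotSpace d) :
    TangentSpace (model d) q →L[ℝ] TangentSpace (model d) q →L[ℝ] ℝ :=
  let B : ℝ × EuclideanSpace ℝ (Fin d) →L[ℝ] ℝ × EuclideanSpace ℝ (Fin d) →L[ℝ] ℝ :=
    metric d r (Quotient.out q)
  let D : ℝ × EuclideanSpace ℝ (Fin d) →L[ℝ] ℝ × EuclideanSpace ℝ (Fin d) :=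
    mfderiv (model d) (model d) (proj d) (Quotient.out q)
  (B.bilinearComp D.inverse D.inverse :
    ℝ × EuclideanSpace ℝ (Fin d) →L[ℝ] ℝ × EuclideanSpace ℝ (Fin d) →L[ℝ] ℝ)

end AdS

end

/-! Put κ = -R/(n(n-1)) with n = d + 1, and look for a radial solution λ = F(s). For a warped
product, (*) splits into a radial equation d(F r'' - F' r') = r and a tangential one.
Differentiating the profile equation gives r'' = κr + a r^(-d), which is `accel` evaluated at r.

Where r' ≠ 0 the radial equation reads (F/r')' = -r/(d r'²). Its integral is singular at the
horizon, but r/r'² = -(r/r'')(1/r')', and integrating by parts leaves F = (r/r'')/d + r'(c - I/d),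
where I(s) is the integral over [0, s] of (ρ/accel ρ)' at ρ = r. As r'' > 0 this is smooth across
the horizon: it is `solution`, and the free constant c multiplies r', a solution of the homogeneous
equation. `solution_first` and `solution_second` verify both components, and
`criticalEquationAt_of_warped` turns them into (*).

For s > 0 one has F = r'(ψ + c) with ψ = `solutionRatio`, and since r is even, reflection replaces c
by -c. Hence one F vanishes at both s and -t exactly when c = -ψ(s) = ψ(t). The function ψ decreases
strictly from +∞, is bounded below, and becomes negative. With L = inf ψ < 0 and ψ(ζ) = -L, the
values beyond ζ fill (L, -L), a symmetric interval: this pairs the spheres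
(`exists_opposite_values`). The zero θ of ψ belongs to c = 0, whose solution is even and so descends
to the quotient.

The geometry enters only through charts. The preferred chart at a point is the identity times
stereographic projection from the antipode. It sends the point to (s, 0), and the metric takes the
same form `warped r` in all these charts, on the manifold (`coordMetric_metric`) and on the quotient
(`coordMetric_quotMetric`). Curvature is therefore needed only at (s, 0), where the conformal factor
is 1 and has zero derivative. -/

noncomputable section

/-! ## The warped product metric in stereographic coordinates -/

namespace WarpedCoord

variable {E : Type*} [NormedAddCommGroup E] [InnerProductSpace ℝ E]

/-- The conformal factor of the round metric in stereographic coordinates. -/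
def conf (z : E) : ℝ := 4 / (‖z‖ ^ 2 + 4)

omit [InnerProductSpace ℝ E] in
theorem conf_pos (z : E) : 0 < conf z := by unfold conf; positivity

theorem contDiff_conf : ContDiff ℝ ∞ (conf : E → ℝ) := by
  unfold conf
  exact contDiff_const.div ((contDiff_norm_sq ℝ).add contDiff_const) fun z => by positivity

theorem hasFDerivAt_conf (z : E) :
    HasFDerivAt (conf : E → ℝ) ((-(conf z ^ 2 / 2)) • innerSL ℝ z) z := by
  have h : HasFDerivAt (fun z : E => ‖z‖ ^ 2 + 4) ((2 : ℝ) • innerSL ℝ z) z := by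
    refine ((hasStrictFDerivAt_norm_sq z).hasFDerivAt.add_const (4 : ℝ)).congr_fderiv ?_
    ext w
    simp
  have hz : ‖z‖ ^ 2 + 4 ≠ 0 := by positivity
  have h2 := ((hasDerivAt_inv hz).comp_hasFDerivAt z h).const_mul 4
  refine (h2.congr_fderiv ?_).congr_of_eventuallyEq (Filter.Eventually.of_forall fun w => ?_)
  · ext w
    simp only [conf, smul_apply, smul_eq_mul, neg_mul, mul_neg]
    field_simp
    ring
  · simp [conf, div_eq_mul_inv]

set_option maxSynthPendingDepth 6 in
/-- The Euclidean inner product of the second components. -/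
def innerSnd : ℝ × E →L[ℝ] ℝ × E →L[ℝ] ℝ :=
  let ip : E →L[ℝ] E →L[ℝ] ℝ := innerSL ℝ
  ip.bilinearComp (.snd ℝ ℝ E) (.snd ℝ ℝ E)

@[simp]
theorem innerSnd_apply (v w : ℝ × E) : innerSnd v w = inner ℝ v.2 w.2 := rfl

set_option maxSynthPendingDepth 6 in
/-- The metric `ds² + r(s)² h`, where `h` is the round metric in stereographic coordinates. -/
def warped (r : ℝ → ℝ) (y : ℝ × E) : ℝ × E →L[ℝ] ℝ × E →L[ℝ] ℝ :=
  (ContinuousLinearMap.mul ℝ ℝ).bilinearComp (.fst ℝ ℝ E) (.fst ℝ ℝ E) +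
    (r y.1 * conf y.2) ^ 2 • innerSnd

theorem warped_apply (r : ℝ → ℝ) (y v w : ℝ × E) :
    warped r y v w = v.1 * w.1 + (r y.1 * conf y.2) ^ 2 * inner ℝ v.2 w.2 := by
  simp [warped]

variable {r : ℝ → ℝ}

set_option maxSynthPendingDepth 6 in
theorem fderiv_warped_apply {r' : ℝ} {y : ℝ × E} (hr : HasDerivAt r r' y.1) (u v w : ℝ × E) :
    fderiv ℝ (warped r) y u v w =
      2 * (r y.1 * conf y.2) * (r' * conf y.2 * u.1
        - r y.1 * (conf y.2 ^ 2 / 2) * inner ℝ y.2 u.2) * inner ℝ v.2 w.2 := by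
  have h1 : HasFDerivAt (fun y : ℝ × E => r y.1) (r' • ContinuousLinearMap.fst ℝ ℝ E) y :=
    hr.comp_hasFDerivAt y hasFDerivAt_fst
  have h2 : HasFDerivAt (fun y : ℝ × E => conf y.2) _ y :=
    (hasFDerivAt_conf y.2).comp y hasFDerivAt_snd
  have h3 := (((h1.mul h2).pow 2).smul_const
    (innerSnd (E := E))).const_add
      ((ContinuousLinearMap.mul ℝ ℝ).bilinearComp (.fst ℝ ℝ E) (.fst ℝ ℝ E))
  have h4 : HasFDerivAt (warped r) _ y := h3
  rw [h4.fderiv]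
  simp [-mul_eq_mul_right_iff]
  ring

variable [FiniteDimensional ℝ E]

theorem isInvertible_warped {y : ℝ × E} (hr : r y.1 ≠ 0) : (warped r y).IsInvertible := by
  have hc := (conf_pos y.2).ne'
  let D : StrongDual ℝ E ≃L[ℝ] E := (InnerProductSpace.toDual ℝ E).symm.toContinuousLinearEquiv
  -- The inverse metric: the radial factor is unchanged, the tangential one is Riesz duality divided
  -- by the conformal scale.
  let e : (ℝ × E →L[ℝ] ℝ) →L[ℝ] ℝ × E :=
    (ContinuousLinearMap.apply ℝ ℝ ((1, 0) : ℝ × E)).prod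
      (((r y.1 * conf y.2) ^ 2)⁻¹ • (D : StrongDual ℝ E →L[ℝ] E) ∘L
          (ContinuousLinearMap.compL ℝ E (ℝ × E) ℝ).flip (.inr ℝ ℝ E))
  have he : ∀ α, e α = (α (1, 0), ((r y.1 * conf y.2) ^ 2)⁻¹ •
      (InnerProductSpace.toDual ℝ E).symm (α ∘L .inr ℝ ℝ E)) := fun α => by simp [e]; rfl
  refine .of_inverse (g := e) ?_ ?_
  · ext α w
    · simp [warped_apply, he]
    · simp [warped_apply, he, inner_smul_left]
      field_simp
  · refine ContinuousLinearMap.ext fun v => ?_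
    simp only [ContinuousLinearMap.comp_apply, he, ContinuousLinearMap.id_apply]
    refine Prod.ext (by simp [warped_apply]) ?_
    refine ext_inner_right ℝ fun w => ?_
    simp [inner_smul_left, warped_apply]
    field_simp

/-- Lowering the index reduces this to an identity for symbols of the first kind, so only
invertibility of the metric is used, not its inverse. -/
theorem christoffel_warped {r' : ℝ} {y : ℝ × E} (hr : HasDerivAt r r' y.1) (h0 : r y.1 ≠ 0)
    (v w : ℝ × E) :
    RiemCoord.christoffel (warped r) y v w =
      (-(r y.1 * r' * conf y.2 ^ 2) * inner ℝ v.2 w.2,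
        (r' / r y.1) • (v.1 • w.2 + w.1 • v.2) - (conf y.2 / 2) •
          (inner ℝ y.2 v.2 • w.2 + inner ℝ y.2 w.2 • v.2 - inner ℝ v.2 w.2 • y.2)) := by
  rw [RiemCoord.christoffel_apply, (isInvertible_warped h0).inverse_apply_eq]
  refine ContinuousLinearMap.ext fun z => ?_
  rw [RiemCoord.christoffelFirst_apply]
  simp only [fderiv_warped_apply hr, warped_apply, inner_sub_left, inner_add_left, inner_smul_left,
    RCLike.conj_to_real]
  field_simp
  ring

theorem differentiable_christoffel_warped (hr : ContDiff ℝ ∞ r) (h0 : ∀ s, r s ≠ 0) :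
    Differentiable ℝ (RiemCoord.christoffel (warped r) : ℝ × E → _) := by
  have hr' : ContDiff ℝ ∞ (deriv r) := ((contDiff_infty_iff_deriv (𝕜 := ℝ)).1 hr).2
  suffices h : ContDiff ℝ ∞ (RiemCoord.christoffel (warped r) : ℝ × E → _) from
    h.differentiable (by simp)
  rw [contDiff_clm_apply_iff]
  intro v
  rw [contDiff_clm_apply_iff]
  intro w
  have e : (fun y => RiemCoord.christoffel (warped r) y v w) = fun y : ℝ × E => _ :=
    funext fun y => christoffel_warped (hr.differentiable (by simp) y.1).hasDerivAt (h0 _) v w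
  rw [e]
  have a1 : ContDiff ℝ ∞ fun y : ℝ × E => r y.1 := hr.comp contDiff_fst
  have a2 : ContDiff ℝ ∞ fun y : ℝ × E => deriv r y.1 := hr'.comp contDiff_fst
  have a3 : ContDiff ℝ ∞ fun y : ℝ × E => conf y.2 := contDiff_conf.comp contDiff_snd
  have a4 : ContDiff ℝ ∞ fun y : ℝ × E => deriv r y.1 / r y.1 := a2.div a1 fun y => h0 _
  have a5 : ContDiff ℝ ∞ fun y : ℝ × E => y.2 := contDiff_snd
  have a6 : ∀ x : E, ContDiff ℝ ∞ fun y : ℝ × E => inner ℝ y.2 x := fun x =>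
    contDiff_snd.inner ℝ contDiff_const
  exact (((a1.mul a2).mul (a3.pow 2)).neg.mul contDiff_const).prodMk
    ((a4.smul contDiff_const).sub ((a3.div_const 2).smul
      ((((a6 v.2).smul contDiff_const).add ((a6 w.2).smul contDiff_const)).sub
        (contDiff_const.smul a5))))

/-- Once differentiability is known, the derivative can be read off along the line t ↦ (s, 0) + t u.
At z = 0 the conformal factor is stationary and contributes nothing. -/
theorem fderiv_christoffel_warped (hr : ContDiff ℝ ∞ r) (h0 : ∀ s, r s ≠ 0) {s r'' : ℝ}
    (hr' : HasDerivAt (deriv r) r'' s) (u v w : ℝ × E) :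
    fderiv ℝ (RiemCoord.christoffel (warped r)) (s, (0 : E)) u v w =
      (-((deriv r s ^ 2 + r s * r'') * u.1) * inner ℝ v.2 w.2,
        ((r'' / r s - (deriv r s / r s) ^ 2) * u.1) • (v.1 • w.2 + w.1 • v.2) - (1 / 2 : ℝ) •
          (inner ℝ u.2 v.2 • w.2 + inner ℝ u.2 w.2 • v.2 - inner ℝ v.2 w.2 • u.2)) := by
  have hd := differentiable_christoffel_warped (E := E) hr h0 (s, 0)
  have hl : HasDerivAt (fun t : ℝ => ((s, 0) : ℝ × E) + t • u) u 0 := by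
    simpa using ((hasDerivAt_id (0 : ℝ)).smul_const u).const_add ((s, 0) : ℝ × E)
  have hd2 : HasDerivAt (fun t : ℝ => RiemCoord.christoffel (warped r) ((s, 0) + t • u)) _ 0 :=
    HasFDerivAt.comp_hasDerivAt (x := (0 : ℝ)) (f := fun t : ℝ => ((s, 0) : ℝ × E) + t • u)
      (l := RiemCoord.christoffel (warped r)) (by simpa using hd.hasFDerivAt) hl
  have hd3 := (hd2.clm_apply (hasDerivAt_const (0 : ℝ) v)).clm_apply (hasDerivAt_const (0 : ℝ) w)
  simp only [map_zero, add_zero] at hd3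
  refine hd3.unique ?_
  have hc : HasDerivAt (fun t : ℝ => conf (t • u.2)) 0 0 := by
    refine HasDerivAt.congr_deriv (HasFDerivAt.comp_hasDerivAt (x := (0 : ℝ))
      (f := fun t : ℝ => t • u.2) (l := conf) (hasFDerivAt_conf _)
      ((hasDerivAt_id (0 : ℝ)).smul_const u.2)) ?_
    simp
  have hr1 : ∀ s, HasDerivAt r (deriv r s) s := fun s =>
    (hr.differentiable (by simp) s).hasDerivAt
  have hs : HasDerivAt (fun t : ℝ => s + t * u.1) u.1 0 := by
    simpa using ((hasDerivAt_id (0 : ℝ)).mul_const u.1).const_add s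
  have hrt : HasDerivAt (fun t : ℝ => r (s + t * u.1)) (deriv r s * u.1) 0 := by
    refine HasDerivAt.congr_deriv (HasDerivAt.comp (0 : ℝ) (h₂ := r)
      (h := fun t : ℝ => s + t * u.1) (hr1 _) hs) ?_
    simp
  have hrt' : HasDerivAt (fun t : ℝ => deriv r (s + t * u.1)) (r'' * u.1) 0 := by
    exact HasDerivAt.comp (0 : ℝ) (h₂ := deriv r) (h := fun t : ℝ => s + t * u.1)
      (by simpa using hr') hs
  have hz : HasDerivAt (fun t : ℝ => t • u.2) u.2 0 := by
    simpa using (hasDerivAt_id (0 : ℝ)).smul_const u.2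
  have hzi : ∀ x : E, HasDerivAt (fun t : ℝ => inner ℝ (t • u.2) x) (inner ℝ u.2 x) 0 := fun x => by
    simpa using hz.inner ℝ (hasDerivAt_const (0 : ℝ) x)
  have e : (fun t : ℝ => RiemCoord.christoffel (warped r) (((s, 0) : ℝ × E) + t • u) v w) =
      fun t : ℝ => _ := funext fun t =>
    christoffel_warped (hr1 _) (h0 _) v w
  rw [e]
  simp only [Prod.fst_add, Prod.snd_add, Prod.smul_fst, Prod.smul_snd, smul_eq_mul, zero_add]
  refine HasDerivAt.prodMk ?_ ?_
  · refine (((hrt.mul hrt').mul (hc.pow 2)).neg.mul_const (inner ℝ v.2 w.2)).congr_deriv ?_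
    simp [conf]
    ring
  · refine (((hrt'.div hrt (by simpa using h0 s)).smul_const (v.1 • w.2 + w.1 • v.2)).sub
      ((hc.div_const 2).smul ((((hzi v.2).smul_const w.2).add ((hzi w.2).smul_const v.2)).sub
        (hz.const_smul (inner ℝ v.2 w.2))))).congr_deriv ?_
    have := h0 s
    simp [conf]
    have e1 : (r'' * u.1 * r s - deriv r s * (deriv r s * u.1)) / r s ^ 2 =
        (r'' / r s - (deriv r s / r s) ^ 2) * u.1 := by
      field_simp
    rw [e1]

/-- This encodes the sectional curvatures -r''/r of planes containing the radial direction and (1 -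
r'²)/r² of planes tangent to the sphere. -/
theorem curvature_warped (hr : ContDiff ℝ ∞ r) (h0 : ∀ s, r s ≠ 0) {s r'' : ℝ}
    (hr' : HasDerivAt (deriv r) r'' s) (u v w : ℝ × E) :
    RiemCoord.curvature (warped r) (s, (0 : E)) u v w =
      (-(r s * r'') * (u.1 * inner ℝ v.2 w.2 - v.1 * inner ℝ u.2 w.2),
        (r'' / r s * w.1) • (u.1 • v.2 - v.1 • u.2) + (1 - deriv r s ^ 2) •
          (inner ℝ v.2 w.2 • u.2 - inner ℝ u.2 w.2 • v.2)) := by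
  have hr1 : ∀ s, HasDerivAt r (deriv r s) s := fun s =>
    (hr.differentiable (by simp) s).hasDerivAt
  have := h0 s
  rw [RiemCoord.curvature, fderiv_christoffel_warped hr h0 hr', fderiv_christoffel_warped hr h0 hr']
  simp only [fun v w => christoffel_warped (y := (s, (0 : E))) (hr1 s) (h0 s) v w]
  have hc : conf (0 : E) = 1 := by simp [conf]
  simp only [hc, inner_zero_left, inner_add_right, inner_sub_right, inner_smul_right,
    inner_zero_right, zero_smul, smul_zero]
  refine Prod.ext ?_ ?_
  · simp only [Prod.fst_add, Prod.fst_sub]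
    rw [real_inner_comm v.2 u.2]
    field_simp
    ring
  · simp only [Prod.snd_add, Prod.snd_sub]
    rw [real_inner_comm v.2 u.2]
    match_scalars <;> field_simp <;> ring

theorem ricci_warped (hr : ContDiff ℝ ∞ r) (h0 : ∀ s, r s ≠ 0) {s r'' : ℝ}
    (hr' : HasDerivAt (deriv r) r'' s) (v w : ℝ × E) :
    RiemCoord.ricci (warped r) (s, (0 : E)) v w =
      -(finrank ℝ E * (r'' / r s)) * (v.1 * w.1) +
        ((finrank ℝ E - 1) * (1 - deriv r s ^ 2) - r s * r'') * inner ℝ v.2 w.2 := by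
  set b : ℝ := -(r'' / r s * w.1 * v.1) + (1 - deriv r s ^ 2) * inner ℝ v.2 w.2 with hb
  -- The map u ↦ R(u, v)w as two rank-one maps plus a multiple of the projection to E, so that its
  -- trace can be read off.
  let L : ℝ × E →ₗ[ℝ] ℝ × E :=
    (LinearMap.fst ℝ ℝ E).smulRight (-(r s * r'') * inner ℝ v.2 w.2, (r'' / r s * w.1) • v.2) +
    ((innerₛₗ ℝ w.2) ∘ₗ (LinearMap.snd ℝ ℝ E)).smulRight
      (r s * r'' * v.1, -(1 - deriv r s ^ 2) • v.2) +
    LinearMap.prodMap 0 (b • LinearMap.id)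
  have hL : RiemCoord.ricci (warped r) (s, (0 : E)) v w = LinearMap.trace ℝ _ L := by
    unfold RiemCoord.ricci
    congr 1
    refine LinearMap.ext fun u => ?_
    simp only [LinearMap.coe_mk, AddHom.coe_mk, curvature_warped hr h0 hr', L, hb]
    refine Prod.ext ?_ ?_
    · simp [real_inner_comm]
      ring
    · simp [real_inner_comm]
      module
  rw [hL]
  simp only [L, map_add, LinearMap.trace_smulRight, LinearMap.trace_prodMap', map_smul,
    LinearMap.trace_id, map_zero]
  simp [hb, inner_smul_right, real_inner_comm v.2 w.2]
  ring

set_option maxSynthPendingDepth 6 in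
theorem hessian_warped (hr : ContDiff ℝ ∞ r) (h0 : ∀ s, r s ≠ 0) {f : ℝ → ℝ}
    (hf : ContDiff ℝ ∞ f) {s f'' : ℝ} (hf' : HasDerivAt (deriv f) f'' s) (v w : ℝ × E) :
    RiemCoord.hessian (warped r) (fun y => f y.1) (s, (0 : E)) v w =
      f'' * (v.1 * w.1) + r s * deriv r s * deriv f s * inner ℝ v.2 w.2 := by
  have hf1 : ∀ y : ℝ × E, HasFDerivAt (fun y : ℝ × E => f y.1)
      (deriv f y.1 • ContinuousLinearMap.fst ℝ ℝ E) y := fun y =>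
    (hf.differentiable (by simp) y.1).hasDerivAt.comp_hasFDerivAt y hasFDerivAt_fst
  have e : fderiv ℝ (fun y : ℝ × E => f y.1) =
      fun y => deriv f y.1 • ContinuousLinearMap.fst ℝ ℝ E := funext fun y => (hf1 y).fderiv
  have hf3 : HasFDerivAt (fun y : ℝ × E => deriv f y.1) (f'' • ContinuousLinearMap.fst ℝ ℝ E)
      (s, (0 : E)) :=
    HasDerivAt.comp_hasFDerivAt (f := Prod.fst) (s, (0 : E)) hf' hasFDerivAt_fst
  have hf2 := hf3.smul_const (ContinuousLinearMap.fst ℝ ℝ E)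
  rw [RiemCoord.hessian_apply, e, hf2.fderiv, christoffel_warped
    (hr.differentiable (by simp) _).hasDerivAt (h0 _)]
  have hc : conf (0 : E) = 1 := by simp [conf]
  simp [hc]
  ring

theorem laplacian_warped (hr : ContDiff ℝ ∞ r) (h0 : ∀ s, r s ≠ 0) {f : ℝ → ℝ}
    (hf : ContDiff ℝ ∞ f) {s f'' : ℝ} (hf' : HasDerivAt (deriv f) f'' s) :
    RiemCoord.laplacian (warped r) (fun y => f y.1) (s, (0 : E)) =
      f'' + finrank ℝ E * (deriv r s / r s) * deriv f s := by
  have key : (((warped r (s, (0 : E))).inverse ∘L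
      RiemCoord.hessian (warped r) (fun y => f y.1) (s, (0 : E)) : ℝ × E →L[ℝ] ℝ × E) :
        ℝ × E →ₗ[ℝ] ℝ × E) =
      LinearMap.prodMap (f'' • LinearMap.id) ((deriv r s / r s * deriv f s) • LinearMap.id) := by
    refine LinearMap.ext fun v => ?_
    simp only [ContinuousLinearMap.coe_coe, ContinuousLinearMap.comp_apply]
    rw [(isInvertible_warped (E := E) (y := (s, 0)) (h0 s)).inverse_apply_eq]
    refine ContinuousLinearMap.ext fun w => ?_
    have := h0 s
    have hc : conf (0 : E) = 1 := by simp [conf]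
    simp [hessian_warped hr h0 hf hf', warped_apply, hc, inner_smul_left]
    field_simp
  rw [RiemCoord.laplacian, key, LinearMap.trace_prodMap', map_smul, map_smul, LinearMap.trace_id,
    LinearMap.trace_id]
  simp
  ring

end WarpedCoord

/-! ## Reduction to coordinates -/

namespace RiemMfd

variable {V : Type*} [NormedAddCommGroup V] [NormedSpace ℝ V]
  {H : Type*} [TopologicalSpace H] (I : ModelWithCorners ℝ V H)
  {M : Type*} [TopologicalSpace M] [ChartedSpace H M]

/-- The tangent space at p is identified with the model space through this very chart, in which its
inverse reads as the identity. -/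
theorem hasMFDerivAt_extChartAt_symm_self [I.Boundaryless] (p : M) :
    HasMFDerivAt 𝓘(ℝ, V) I (extChartAt I p).symm (extChartAt I p p)
      (ContinuousLinearMap.id ℝ V) := by
  have ht : (extChartAt I p).target ∈ 𝓝 (extChartAt I p p) :=
    extChartAt_target_mem_nhds p
  refine ⟨continuousAt_extChartAt_symm p, ?_⟩
  have e : writtenInExtChartAt 𝓘(ℝ, V) I (extChartAt I p p) (extChartAt I p).symm =ᶠ[
      𝓝 (extChartAt I p p)] id := by
    filter_upwards [ht] with y hy
    have h1 : writtenInExtChartAt 𝓘(ℝ, V) I (extChartAt I p p) (extChartAt I p).symm y =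
      extChartAt I ((extChartAt I p).symm (extChartAt I p p)) ((extChartAt I p).symm y) := rfl
    rw [h1, extChartAt_to_inv]
    exact (extChartAt I p).right_inv hy
  exact (HasFDerivAt.congr_of_eventuallyEq (hasFDerivAt_id _) e).hasFDerivWithinAt

theorem coordMetric_extChartAt_self [I.Boundaryless]
    (g : ∀ q : M, TangentSpace I q →L[ℝ] TangentSpace I q →L[ℝ] ℝ) (p : M) (v w : V) :
    coordMetric I g p (extChartAt I p p) v w = g p v w := by
  have h : ∀ q : M, q = p → (g q : V →L[ℝ] V →L[ℝ] ℝ) = g p := by rintro q rfl; rfl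
  have hD : (mfderiv 𝓘(ℝ, V) I (extChartAt I p).symm (extChartAt I p p) : V →L[ℝ] V) =
    ContinuousLinearMap.id ℝ V := (hasMFDerivAt_extChartAt_symm_self I p).mfderiv
  have h1 : ∀ y : V, ∀ D : V →L[ℝ] V, D = mfderiv 𝓘(ℝ, V) I (extChartAt I p).symm y →
      ∀ B : V →L[ℝ] V →L[ℝ] ℝ, B = g ((extChartAt I p).symm y) →
      coordMetric I g p y v w = B (D v) (D w) := by
    rintro y _ rfl _ rfl
    rfl
  exact h1 _ _ hD.symm _ (h _ (extChartAt_to_inv p)).symm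

open WarpedCoord in
/-- The equation `-(Δ f) g + ∇² f - f Ric = g` for a metric that is a warped product in coordinates
and a function that depends on the first coordinate only. -/
theorem criticalEquationAt_of_warped {E : Type*} [NormedAddCommGroup E] [InnerProductSpace ℝ E]
    [FiniteDimensional ℝ E] {H : Type*} [TopologicalSpace H] (I : ModelWithCorners ℝ (ℝ × E) H)
    [I.Boundaryless] {M : Type*} [TopologicalSpace M] [ChartedSpace H M]
    {g : ∀ q : M, TangentSpace I q →L[ℝ] TangentSpace I q →L[ℝ] ℝ} {f : M → ℝ} {p : M}
    {r F : ℝ → ℝ} {s r'' F'' : ℝ} (hr : ContDiff ℝ ∞ r) (h0 : ∀ s, r s ≠ 0)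
    (hF : ContDiff ℝ ∞ F) (hr'' : HasDerivAt (deriv r) r'' s) (hF'' : HasDerivAt (deriv F) F'' s)
    (hg : coordMetric I g p = warped r) (hf : f ∘ (extChartAt I p).symm = fun y => F y.1)
    (hp : extChartAt I p p = (s, 0))
    (h1 : finrank ℝ E * (F s * r'' - deriv F s * deriv r s) = r s)
    (h2 : -(r s ^ 2 * F'') - (finrank ℝ E - 1) * r s * deriv r s * deriv F s
      - F s * ((finrank ℝ E - 1) * (1 - deriv r s ^ 2) - r s * r'') = r s ^ 2) :
    CriticalEquationAt I g f p := by
  suffices h : ∀ v w : ℝ × E, -(laplacian I g f p) * (g p : ℝ × E →L[ℝ] ℝ × E →L[ℝ] ℝ) v w +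
      RiemCoord.hessian (coordMetric I g p) (f ∘ (extChartAt I p).symm) (extChartAt I p p) v w -
      f p * RiemCoord.ricci (coordMetric I g p) (extChartAt I p p) v w =
      (g p : ℝ × E →L[ℝ] ℝ × E →L[ℝ] ℝ) v w from h
  intro v w
  have hfp : f p = F s := by
    have := congrFun hf (extChartAt I p p)
    rwa [Function.comp_apply, extChartAt_to_inv, hp] at this
  have hgp : (g p : ℝ × E →L[ℝ] ℝ × E →L[ℝ] ℝ) v w = warped r (s, 0) v w := by
    rw [← hg, ← hp]; exact (coordMetric_extChartAt_self I g p v w).symm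
  rw [laplacian, hg, hf, hp, laplacian_warped hr h0 hF hF'',
    hessian_warped hr h0 hF hF'', ricci_warped hr h0 hr'', hgp, warped_apply, hfp]
  have hc : conf (0 : E) = 1 := by simp [conf]
  have := h0 s
  simp only [hc]
  have h1' : finrank ℝ E * (F s * (r'' / r s) - deriv F s * (deriv r s / r s)) = 1 := by
    field_simp
    linarith
  -- The Hessian cancels one of the `finrank ℝ E` copies of r r' F' coming from the Laplacian, which
  -- is why `h2` has `finrank ℝ E - 1`.
  have h2' : -(r s ^ 2 * (F'' + finrank ℝ E * (deriv r s / r s) * deriv F s)) +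
      r s * deriv r s * deriv F s
      - F s * ((finrank ℝ E - 1) * (1 - deriv r s ^ 2) - r s * r'') = r s ^ 2 := by
    have hq : deriv r s / r s * r s = deriv r s := div_mul_cancel₀ _ this
    linear_combination h2 - (finrank ℝ E * r s * deriv F s) * hq
  linear_combination (v.1 * w.1) * h1' + (inner ℝ v.2 w.2) * h2'

end RiemMfd

/-! ### Stereographic charts of `ℝ × 𝕊ᵈ`. -/

namespace AdS

open WarpedCoord RiemMfd

variable (d : ℕ)

theorem extChartAt_symm_fst (p : Space d) (y : ℝ × EuclideanSpace ℝ (Fin d)) :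
    ((extChartAt (model d) p).symm y).1 = y.1 := rfl

theorem extChartAt_target (p : Space d) : (extChartAt (model d) p).target = univ := by
  have : (chartAt (EuclideanSpace ℝ (Fin d)) p.2).target = univ :=
    have := Fact.mk (@finrank_euclideanSpace_fin ℝ _ (d + 1))
    stereographic'_target (-p.2)
  have h' : (chartAt ℝ p.1).target = univ := rfl
  rw [extChartAt_prod, PartialEquiv.prod_target]
  simp [this, h']

theorem extChartAt_self (p : Space d) : extChartAt (model d) p p = (p.1, 0) := by
  have := Fact.mk (@finrank_euclideanSpace_fin ℝ _ (d + 1))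
  have : chartAt (EuclideanSpace ℝ (Fin d)) p.2 p.2 = 0 := by
    change stereographic' d (-p.2) p.2 = 0
    change (OrthonormalBasis.fromOrthogonalSpanSingleton d
      (ne_zero_of_mem_unit_sphere (-p.2))).repr (stereographic (norm_eq_of_mem_sphere (-p.2)) p.2) = 0
    rw [stereographic_neg_apply, map_zero]
  have h' : chartAt ℝ p.1 p.1 = p.1 := rfl
  rw [extChartAt_prod, PartialEquiv.prod_coe]
  simp [this, h']

/-- Here N is the antipode of the sphere component of p, the pole of the projection, and U embeds
the coordinates isometrically as the hyperplane orthogonal to N. -/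
theorem exists_extChartAt_symm_snd (p : Space d) :
    ∃ (N : EuclideanSpace ℝ (Fin (d + 1)))
      (U : EuclideanSpace ℝ (Fin d) →ₗᵢ[ℝ] EuclideanSpace ℝ (Fin (d + 1))),
      ‖N‖ = 1 ∧ (∀ z, inner ℝ (U z) N = 0) ∧ ∀ y,
        (((extChartAt (model d) p).symm y).2 : EuclideanSpace ℝ (Fin (d + 1))) =
          stereoInvFunAux N (U y.2) := by
  have := Fact.mk (@finrank_euclideanSpace_fin ℝ _ (d + 1))
  let N := -p.2
  let U : (Submodule.span ℝ {(N : EuclideanSpace ℝ (Fin (d + 1)))})ᗮ ≃ₗᵢ[ℝ]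
      EuclideanSpace ℝ (Fin d) :=
    (OrthonormalBasis.fromOrthogonalSpanSingleton d (ne_zero_of_mem_unit_sphere N)).repr
  refine ⟨N, (Submodule.subtypeₗᵢ _).comp U.symm.toLinearIsometry, norm_eq_of_mem_sphere N,
    fun z => ?_, fun y => ?_⟩
  · have := (U.symm z).2
    rw [Submodule.mem_orthogonal_singleton_iff_inner_left] at this
    exact this
  · rfl

/-- Inverse stereographic projection is conformal: it equals conf(z) U z + (1 - 2 conf(z)) N, and U
z is orthogonal to the unit vector N. -/
theorem inner_fderiv_stereoInvFunAux {E F : Type*} [NormedAddCommGroup E] [InnerProductSpace ℝ E]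
    [NormedAddCommGroup F] [InnerProductSpace ℝ F] {N : F} (hN : ‖N‖ = 1) (U : E →ₗᵢ[ℝ] F)
    (hU : ∀ z, inner ℝ (U z) N = 0) (z : E) :
    ∃ D : E →L[ℝ] F, HasFDerivAt (fun z => stereoInvFunAux N (U z)) D z ∧
      ∀ v w, inner ℝ (D v) (D w) = conf z ^ 2 * inner ℝ v w := by
  have e : (fun z => stereoInvFunAux N (U z)) =
      fun z => conf z • U z + (1 - 2 * conf z) • N := by
    funext z
    have : ‖z‖ ^ 2 + 4 ≠ 0 := by positivity
    simp only [stereoInvFunAux_apply, conf, LinearIsometry.norm_map]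
    match_scalars
    · field_simp
    · field_simp
      ring
  have hc := hasFDerivAt_conf z
  have hD := (hc.smul U.toContinuousLinearMap.hasFDerivAt).add
    (((hc.const_mul 2).const_sub 1).smul_const N)
  refine ⟨_, by rw [e]; exact hD, fun v w => ?_⟩
  have hU' : ∀ z, inner ℝ N (U z) = 0 := fun z => by rw [real_inner_comm, hU]
  have hzz : ‖z‖ ^ 2 * conf z = 4 - 4 * conf z := by
    have : ‖z‖ ^ 2 + 4 ≠ 0 := by positivity
    rw [conf]; field_simp; ring
  simp [inner_add_left, inner_add_right, inner_smul_left, inner_smul_right, hN, hU, hU',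
    LinearIsometry.inner_map_map]
  rw [real_inner_comm z v]
  linear_combination (conf z ^ 3 / 4 * inner ℝ z v * inner ℝ z w) * hzz

theorem mdifferentiableAt_extChartAt_symm (p : Space d) (y : ℝ × EuclideanSpace ℝ (Fin d)) :
    MDifferentiableAt 𝓘(ℝ, ℝ × EuclideanSpace ℝ (Fin d)) (model d)
      (extChartAt (model d) p).symm y := by
  have := (contMDiffOn_extChartAt_symm (I := model d) (n := 1) p).mdifferentiableOn one_ne_zero
  rw [extChartAt_target] at this
  exact (this y (mem_univ _)).mdifferentiableAt Filter.univ_mem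

theorem mdifferentiableAt_fst (p : Space d) :
    MDifferentiableAt (model d) 𝓘(ℝ, ℝ) (fun q : Space d => q.1) p :=
  _root_.mdifferentiableAt_fst

theorem mdifferentiableAt_snd (p : Space d) :
    MDifferentiableAt (model d) 𝓘(ℝ, EuclideanSpace ℝ (Fin (d + 1)))
      (fun q : Space d => (q.2 : EuclideanSpace ℝ (Fin (d + 1)))) p := by
  have := Fact.mk (@finrank_euclideanSpace_fin ℝ _ (d + 1))
  have h : ContMDiff (𝓡 d) 𝓘(ℝ, EuclideanSpace ℝ (Fin (d + 1))) 1
    ((↑) : sphere (0 : EuclideanSpace ℝ (Fin (d + 1))) 1 → EuclideanSpace ℝ (Fin (d + 1))) :=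
    contMDiff_coe_sphere
  exact MDifferentiableAt.comp p ((h p.2).mdifferentiableAt one_ne_zero) _root_.mdifferentiableAt_snd

/-- The differential of the signed distance to the horizon. -/
def dFst (p : Space d) : ℝ × EuclideanSpace ℝ (Fin d) →L[ℝ] ℝ :=
  mvfderiv (model d) (fun q : Space d => q.1) p

/-- The differential of the inclusion of the sphere into Euclidean space. -/
def dSnd (p : Space d) : ℝ × EuclideanSpace ℝ (Fin d) →L[ℝ] EuclideanSpace ℝ (Fin (d + 1)) :=
  mvfderiv (model d) (fun q : Space d => (q.2 : EuclideanSpace ℝ (Fin (d + 1)))) p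

theorem hasMFDerivAt_dFst (p : Space d) :
    HasMFDerivAt (model d) 𝓘(ℝ, ℝ) (fun q : Space d => q.1) p (dFst d p) :=
  (mdifferentiableAt_fst d p).hasMFDerivAt

theorem hasMFDerivAt_dSnd (p : Space d) :
    HasMFDerivAt (model d) 𝓘(ℝ, EuclideanSpace ℝ (Fin (d + 1)))
      (fun q : Space d => (q.2 : EuclideanSpace ℝ (Fin (d + 1)))) p (dSnd d p) :=
  (mdifferentiableAt_snd d p).hasMFDerivAt

/-- In the preferred charts the metric is the warped product metric in stereographic
coordinates. -/
theorem coordMetric_metric (r : ℝ → ℝ) (p : Space d) :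
    coordMetric (model d) (metric d r) p = warped r := by
  funext y
  refine ContinuousLinearMap.ext fun v => ContinuousLinearMap.ext fun w => ?_
  obtain ⟨T, hT⟩ : ∃ T : ℝ × EuclideanSpace ℝ (Fin d) →L[ℝ] ℝ × EuclideanSpace ℝ (Fin d),
    T = mfderiv 𝓘(ℝ, ℝ × EuclideanSpace ℝ (Fin d)) (model d) (extChartAt (model d) p).symm y :=
    ⟨_, rfl⟩
  have hs : HasMFDerivAt 𝓘(ℝ, ℝ × EuclideanSpace ℝ (Fin d)) (model d)
      (extChartAt (model d) p).symm y T :=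
    hT ▸ (mdifferentiableAt_extChartAt_symm d p y).hasMFDerivAt
  set x := (extChartAt (model d) p).symm y with hx
  obtain ⟨N, U, hN, hU, hxU⟩ := exists_extChartAt_symm_snd d p
  obtain ⟨D, hD, hD'⟩ := inner_fderiv_stereoInvFunAux hN U hU y.2
  have h1 : dFst d x ∘L T = .fst ℝ ℝ _ := by
    have h : HasFDerivAt (Prod.fst : ℝ × EuclideanSpace ℝ (Fin d) → ℝ) (dFst d x ∘L T) y :=
      (HasMFDerivAt.comp (g := fun q : Space d => q.1) (f := (extChartAt (model d) p).symm) y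
        (hasMFDerivAt_dFst d x) hs).hasFDerivAt
    exact h.unique hasFDerivAt_fst
  have h2 : dSnd d x ∘L T = D ∘L .snd ℝ ℝ _ := by
    have h : HasFDerivAt (fun y => (((extChartAt (model d) p).symm y).2 :
        EuclideanSpace ℝ (Fin (d + 1)))) (dSnd d x ∘L T) y :=
      (HasMFDerivAt.comp (g := fun q : Space d => (q.2 : EuclideanSpace ℝ (Fin (d + 1))))
        (f := (extChartAt (model d) p).symm) y (hasMFDerivAt_dSnd d x) hs).hasFDerivAt
    rw [funext hxU] at h
    exact h.unique (HasFDerivAt.comp (g := fun z => stereoInvFunAux N (U z)) y hD hasFDerivAt_snd)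
  have h3 : ∀ T : ℝ × EuclideanSpace ℝ (Fin d) →L[ℝ] ℝ × EuclideanSpace ℝ (Fin d),
      T = mfderiv 𝓘(ℝ, ℝ × EuclideanSpace ℝ (Fin d)) (model d) (extChartAt (model d) p).symm y →
      coordMetric (model d) (metric d r) p y v w =
        dFst d x (T v) * dFst d x (T w) + r x.1 ^ 2 * inner ℝ (dSnd d x (T v)) (dSnd d x (T w)) := by
    rintro _ rfl
    rfl
  have h1' := fun v => DFunLike.congr_fun h1 v
  have h2' := fun v => DFunLike.congr_fun h2 v
  simp only [ContinuousLinearMap.comp_apply, ContinuousLinearMap.coe_fst',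
    ContinuousLinearMap.coe_snd'] at h1' h2'
  rw [h3 T hT, h1', h1', h2', h2', hD', warped_apply, hx, extChartAt_symm_fst]
  ring

end AdS

namespace AdS

open WarpedCoord RiemMfd

variable (d : ℕ)

/-! ## The quotient -/

theorem isLocalHomeomorph_proj : IsLocalHomeomorph (proj d) :=
  (isQuotientCoveringMap_quotientMk_of_properlyDiscontinuousSMul
    (G := ℤˣ) (E := Space d)).isCoveringMap.isLocalHomeomorph

theorem proj_surjective : Function.Surjective (proj d) := Quotient.mk_surjective

theorem proj_smul (u : ℤˣ) (p : Space d) : proj d (u • p) = proj d p :=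
  Quotient.sound ⟨u, rfl⟩

theorem exists_smul_eq_of_proj_eq {p q : Space d} (h : proj d p = proj d q) :
    ∃ u : ℤˣ, u • q = p := Quotient.eq''.1 h

/-- The preferred charts of the quotient in terms of those of `ℝ × 𝕊ᵈ`. -/
theorem exists_lift (q : QuotSpace d) :
    ∃ p, proj d p = q ∧ (extChartAt (model d) q).symm = proj d ∘ (extChartAt (model d) p).symm ∧
      ∀ (u : ℤˣ) (x : Space d), u • x = p →
        extChartAt (model d) q ∘ proj d =ᶠ[𝓝 x] extChartAt (model d) p ∘ (u • ·) := by
  have hl := isLocalHomeomorph_proj d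
  obtain ⟨p, hp, hc⟩ : ∃ p, proj d p = q ∧
      chartAt (ModelProd ℝ (EuclideanSpace ℝ (Fin d))) q =
        (hl.localInverseAt p).trans (chartAt (ModelProd ℝ (EuclideanSpace ℝ (Fin d))) p) :=
    ⟨(proj_surjective d).hasRightInverse.choose q,
      (proj_surjective d).hasRightInverse.choose_spec q, rfl⟩
  have h1 : (extChartAt (model d) q : QuotSpace d → _) =
      extChartAt (model d) p ∘ hl.localInverseAt p := by
    rw [extChartAt, hc]
    rfl
  have h2 : ((extChartAt (model d) q).symm : _ → QuotSpace d) =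
      (hl.localInverseAt p).symm ∘ (extChartAt (model d) p).symm := by
    rw [extChartAt, hc]
    rfl
  refine ⟨p, hp, by rw [h2, hl.localInverseAt_symm], fun u x hu => ?_⟩
  have ht : (hl.localInverseAt p).target ∈ 𝓝 (u • x) := by
    rw [hu]
    exact (hl.localInverseAt p).open_target.mem_nhds hl.self_mem_localInverseAt_target
  filter_upwards [(continuous_const_smul u).continuousAt.preimage_mem_nhds ht] with x' hx'
  have h3 : hl.localInverseAt p (proj d x') = u • x' := by
    rw [← proj_smul d u x']
    have := (hl.localInverseAt p).right_inv hx'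
    rwa [hl.localInverseAt_symm] at this
  rw [h1]
  simp only [Function.comp_apply, h3]

theorem contMDiff_smul (u : ℤˣ) : ContMDiff (model d) (model d) ∞ (fun x : Space d => u • x) := by
  have := Fact.mk (@finrank_euclideanSpace_fin ℝ _ (d + 1))
  rcases Int.units_eq_one_or u with rfl | rfl
  · simpa using! contMDiff_id
  · have h : ContMDiff (𝓡 d) (𝓡 d) ∞
        (fun x : sphere (0 : EuclideanSpace ℝ (Fin (d + 1))) 1 => -x) := contMDiff_neg_sphere
    simp only [neg_one_smul_eq]
    exact (contMDiff_fst.neg).prodMk (h.comp contMDiff_snd)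

/-- The differential of the action of `±1`. -/
def dSMul (u : ℤˣ) (x : Space d) :
    ℝ × EuclideanSpace ℝ (Fin d) →L[ℝ] ℝ × EuclideanSpace ℝ (Fin d) :=
  mfderiv (model d) (model d) (fun x : Space d => u • x) x

theorem hasMFDerivAt_dSMul (u : ℤˣ) (x : Space d) :
    HasMFDerivAt (model d) (model d) (fun x : Space d => u • x) x (dSMul d u x) :=
  ((contMDiff_smul d u).mdifferentiableAt (by simp)).hasMFDerivAt

theorem dSMul_comp (u : ℤˣ) (x : Space d) :
    dSMul d u (u • x) ∘L dSMul d u x = .id ℝ _ := by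
  have h := (hasMFDerivAt_dSMul d u (u • x)).comp x (hasMFDerivAt_dSMul d u x)
  have e : (fun x : Space d => u • x) ∘ (fun x : Space d => u • x) = id := by
    funext x
    simp [smul_smul, ← sq]
  rw [e] at h
  exact hasMFDerivAt_unique h (hasMFDerivAt_id x)

theorem isInvertible_dSMul (u : ℤˣ) (x : Space d) : (dSMul d u x).IsInvertible := by
  refine .of_inverse (g := dSMul d u (u • x)) ?_ (dSMul_comp d u x)
  have h := dSMul_comp d u (u • x)
  rwa [smul_smul, ← sq, Int.units_sq, one_smul] at h

/-- In the charts of `exists_lift` the projection near x reads as the action of some u = ±1, whose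
differential is invertible. -/
theorem hasMFDerivAt_proj (x : Space d) :
    ∃ T : ℝ × EuclideanSpace ℝ (Fin d) →L[ℝ] ℝ × EuclideanSpace ℝ (Fin d),
      T.IsInvertible ∧ HasMFDerivAt (model d) (model d) (proj d) x T := by
  obtain ⟨p, hp, -, hc⟩ := exists_lift d (proj d x)
  obtain ⟨u, rfl⟩ := exists_smul_eq_of_proj_eq d hp
  refine ⟨dSMul d u x, isInvertible_dSMul d u x,
    (isLocalHomeomorph_proj d).continuous.continuousAt, ?_⟩
  refine (hasMFDerivAt_dSMul d u x).2.congr_of_eventuallyEq ?_ ?_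
  · have hx : Filter.Tendsto (extChartAt (model d) x).symm (𝓝 (extChartAt (model d) x x)) (𝓝 x) := by
      have h := continuousAt_extChartAt_symm (I := model d) x
      rwa [ContinuousAt, extChartAt_to_inv] at h
    exact Filter.Eventually.filter_mono nhdsWithin_le_nhds (hx.eventually (hc u x rfl))
  · have := (hc u x rfl).self_of_nhds
    simp only [writtenInExtChartAt, Function.comp_apply, extChartAt_to_inv] at this ⊢
    exact this

theorem metric_smul {r : ℝ → ℝ} (hr : ∀ s, r (-s) = r s) (u : ℤˣ) (x : Space d)
    (v w : ℝ × EuclideanSpace ℝ (Fin d)) :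
    (metric d r (u • x) : _ →L[ℝ] _ →L[ℝ] ℝ) (dSMul d u x v) (dSMul d u x w) =
      (metric d r x : _ →L[ℝ] _ →L[ℝ] ℝ) v w := by
  have key : ∀ (x : Space d) (v w : ℝ × EuclideanSpace ℝ (Fin d)),
      (metric d r x : ℝ × EuclideanSpace ℝ (Fin d) →L[ℝ] ℝ × EuclideanSpace ℝ (Fin d) →L[ℝ] ℝ) v w
        = dFst d x v * dFst d x w + r x.1 ^ 2 * inner ℝ (dSnd d x v) (dSnd d x w) :=
    fun _ _ _ => rfl
  have h1 := HasMFDerivAt.comp (g := fun q : Space d => q.1) (f := fun x : Space d => u • x) x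
    (hasMFDerivAt_dFst d (u • x)) (hasMFDerivAt_dSMul d u x)
  have h2 := HasMFDerivAt.comp (g := fun q : Space d => (q.2 : EuclideanSpace ℝ (Fin (d + 1))))
    (f := fun x : Space d => u • x) x
    (hasMFDerivAt_dSnd d (u • x)) (hasMFDerivAt_dSMul d u x)
  -- The action multiplies both ds and dx by the same sign c; the metric is quadratic in them, so
  -- the sign drops out.
  obtain ⟨c, hc, h3, h4, h5⟩ : ∃ c : ℝ, c * c = 1 ∧
      dFst d (u • x) ∘L dSMul d u x = c • dFst d x ∧
      dSnd d (u • x) ∘L dSMul d u x = c • dSnd d x ∧ r (u • x).1 = r x.1 := by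
    rcases Int.units_eq_one_or u with rfl | rfl
    · refine ⟨1, by simp, ?_, ?_, by simp⟩
      · rw [one_smul]
        refine hasMFDerivAt_unique h1 ?_
        simpa using! hasMFDerivAt_dFst d x
      · rw [one_smul]
        refine hasMFDerivAt_unique h2 ?_
        simpa using! hasMFDerivAt_dSnd d x
    · refine ⟨-1, by simp, ?_, ?_, by simp [neg_one_smul_eq, hr]⟩
      · exact (hasMFDerivAt_unique h1 (hasMFDerivAt_dFst d x).neg).trans
          (neg_one_smul ℝ (dFst d x)).symm
      · exact (hasMFDerivAt_unique h2 (hasMFDerivAt_dSnd d x).neg).trans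
          (neg_one_smul ℝ (dSnd d x)).symm
  have h3' := fun v => DFunLike.congr_fun h3 v
  have h4' := fun v => DFunLike.congr_fun h4 v
  simp only [ContinuousLinearMap.comp_apply, smul_apply] at h3' h4'
  rw [key, key, h3', h3', h4', h4', h5, real_inner_smul_left, real_inner_smul_right, smul_eq_mul,
    smul_eq_mul]
  linear_combination (dFst d x v * dFst d x w + r x.1 ^ 2 * inner ℝ (dSnd d x v) (dSnd d x w)) * hc

/-- The projection is a local isometry. -/
theorem quotMetric_proj {r : ℝ → ℝ} (hr : ∀ s, r (-s) = r s) (x : Space d)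
    {T : ℝ × EuclideanSpace ℝ (Fin d) →L[ℝ] ℝ × EuclideanSpace ℝ (Fin d)}
    (hT : HasMFDerivAt (model d) (model d) (proj d) x T) (v w : ℝ × EuclideanSpace ℝ (Fin d)) :
    (quotMetric d r (proj d x) : _ →L[ℝ] _ →L[ℝ] ℝ) (T v) (T w) =
      (metric d r x : _ →L[ℝ] _ →L[ℝ] ℝ) v w := by
  -- The representative used in `quotMetric` may differ from x by u; invariance under the action
  -- removes the discrepancy.
  obtain ⟨u, hu⟩ := exists_smul_eq_of_proj_eq d
    (show proj d (Quotient.out (proj d x)) = proj d x from Quotient.out_eq _)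
  obtain ⟨D, hDi, hD⟩ := hasMFDerivAt_proj d (u • x)
  have e : proj d ∘ (fun x => u • x) = proj d := funext fun x => proj_smul d u x
  have hc := HasMFDerivAt.comp (g := proj d) (f := fun x : Space d => u • x) x hD
    (hasMFDerivAt_dSMul d u x)
  rw [e] at hc
  have hTD : T = D ∘L dSMul d u x := hasMFDerivAt_unique hT hc
  have hi : ∀ v, D.inverse (T v) = dSMul d u x v := fun v => by
    rw [hDi.inverse_apply_eq, hTD]
    rfl
  have key : ∀ (x' : Space d) (D' : ℝ × EuclideanSpace ℝ (Fin d) →L[ℝ] ℝ × EuclideanSpace ℝ (Fin d)),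
      x' = Quotient.out (proj d x) → HasMFDerivAt (model d) (model d) (proj d) x' D' →
      ∀ v w : ℝ × EuclideanSpace ℝ (Fin d),
      (quotMetric d r (proj d x) : ℝ × EuclideanSpace ℝ (Fin d) →L[ℝ]
        ℝ × EuclideanSpace ℝ (Fin d) →L[ℝ] ℝ) v w =
      (metric d r x' : ℝ × EuclideanSpace ℝ (Fin d) →L[ℝ]
        ℝ × EuclideanSpace ℝ (Fin d) →L[ℝ] ℝ)
        (D'.inverse v)
        (D'.inverse w) := by
    rintro _ D' rfl hD' v w
    obtain rfl := hD'.mfderiv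
    rfl
  refine (key _ D hu hD (T v) (T w)).trans ?_
  rw [hi, hi]
  exact metric_smul d hr u x v w

/-- The inverse chart at q is the inverse chart at a lift p followed by the projection, a local
isometry, so both coordinate metrics agree. -/
theorem coordMetric_quotMetric {r : ℝ → ℝ} (hr : ∀ s, r (-s) = r s) (q : QuotSpace d) :
    coordMetric (model d) (quotMetric d r) q = warped r := by
  obtain ⟨p, hp, hs, -⟩ := exists_lift d q
  rw [← coordMetric_metric d r p]
  funext y
  refine ContinuousLinearMap.ext fun v => ContinuousLinearMap.ext fun w => ?_
  obtain ⟨S, hS⟩ : ∃ S : ℝ × EuclideanSpace ℝ (Fin d) →L[ℝ] ℝ × EuclideanSpace ℝ (Fin d),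
    S = mfderiv 𝓘(ℝ, ℝ × EuclideanSpace ℝ (Fin d)) (model d) (extChartAt (model d) p).symm y :=
    ⟨_, rfl⟩
  have hS' : HasMFDerivAt 𝓘(ℝ, ℝ × EuclideanSpace ℝ (Fin d)) (model d)
      (extChartAt (model d) p).symm y S :=
    hS ▸ (mdifferentiableAt_extChartAt_symm d p y).hasMFDerivAt
  obtain ⟨T, -, hT⟩ := hasMFDerivAt_proj d ((extChartAt (model d) p).symm y)
  have hTS := HasMFDerivAt.comp (g := proj d) (f := (extChartAt (model d) p).symm) y hT hS'
  rw [← hs] at hTS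
  have key : ∀ q', q' = (extChartAt (model d) q).symm y →
      ∀ L : ℝ × EuclideanSpace ℝ (Fin d) →L[ℝ] ℝ × EuclideanSpace ℝ (Fin d),
      HasMFDerivAt 𝓘(ℝ, ℝ × EuclideanSpace ℝ (Fin d)) (model d)
        (extChartAt (model d) q).symm y L →
      coordMetric (model d) (quotMetric d r) q y v w =
      (quotMetric d r q' : ℝ × EuclideanSpace ℝ (Fin d) →L[ℝ]
        ℝ × EuclideanSpace ℝ (Fin d) →L[ℝ] ℝ)
        (L v)
        (L w) := by
    rintro _ rfl L hL
    obtain rfl := hL.mfderiv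
    rfl
  have key' : ∀ S : ℝ × EuclideanSpace ℝ (Fin d) →L[ℝ] ℝ × EuclideanSpace ℝ (Fin d),
      S = mfderiv 𝓘(ℝ, ℝ × EuclideanSpace ℝ (Fin d)) (model d)
        (extChartAt (model d) p).symm y →
      coordMetric (model d) (metric d r) p y v w =
      (metric d r ((extChartAt (model d) p).symm y) : ℝ × EuclideanSpace ℝ (Fin d) →L[ℝ]
        ℝ × EuclideanSpace ℝ (Fin d) →L[ℝ] ℝ)
        (S v)
        (S w) := by
    rintro _ rfl
    rfl
  rw [key _ (by rw [hs]) _ hTS, key' _ hS]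
  exact quotMetric_proj d hr _ hT (S v) (S w)

theorem extChartAt_quot_self {p : Space d} {q : QuotSpace d} (hp : proj d p = q)
    (hc : extChartAt (model d) q ∘ proj d =ᶠ[𝓝 p] extChartAt (model d) p ∘ ((1 : ℤˣ) • ·)) :
    extChartAt (model d) q q = (p.1, 0) := by
  have := hc.self_of_nhds
  simp only [Function.comp_apply, one_smul, hp] at this
  rw [this, extChartAt_self]

end AdS

/-! ## The radial equations -/

namespace AdS

/-- Half the derivative of the potential, as a function of the area radius: `r'' = accel r`. -/
def accel (d : ℕ) (κ a ρ : ℝ) : ℝ := κ * ρ + a * ρ ^ (-(d : ℤ))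

/-- The derivative of `accel`. -/
def accelDeriv (d : ℕ) (κ a ρ : ℝ) : ℝ := κ - a * d * ρ ^ (-(d : ℤ) - 1)

section accel

variable {d : ℕ} {κ a ρ : ℝ}

theorem hasDerivAt_accel (hρ : ρ ≠ 0) :
    HasDerivAt (accel d κ a) (accelDeriv d κ a ρ) ρ := by
  have h := ((hasDerivAt_id ρ).const_mul κ).add ((hasDerivAt_zpow (-(d : ℤ)) ρ (.inl hρ)).const_mul a)
  refine h.congr_deriv ?_
  simp [accelDeriv]
  ring

theorem accel_pos (hκ : 0 < κ) (ha : 0 < a) (hρ : 0 < ρ) : 0 < accel d κ a ρ := by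
  unfold accel; positivity

/-- The terms in κ cancel. What remains is positive for positive a and ρ, so ρ/accel ρ is
increasing. -/
theorem accel_sub_mul_accelDeriv (hρ : ρ ≠ 0) :
    accel d κ a ρ - ρ * accelDeriv d κ a ρ = a * (d + 1) * ρ ^ (-(d : ℤ)) := by
  rw [accel, accelDeriv, zpow_sub_one₀ hρ]
  field_simp
  ring

theorem contDiffAt_accel (hρ : ρ ≠ 0) : ContDiffAt ℝ ∞ (accel d κ a) ρ := by
  have : ContDiffAt ℝ ∞ (fun ρ : ℝ => ρ ^ (-(d : ℤ))) ρ := by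
    simp only [zpow_neg, zpow_natCast]
    exact (contDiffAt_id.pow d).inv (pow_ne_zero _ hρ)
  exact (contDiffAt_const.mul contDiffAt_id).add (contDiffAt_const.mul this)

theorem contDiffAt_accelDeriv (hρ : ρ ≠ 0) : ContDiffAt ℝ ∞ (accelDeriv d κ a) ρ := by
  have : ContDiffAt ℝ ∞ (fun ρ : ℝ => ρ ^ (-(d : ℤ) - 1)) ρ := by
    have e : (-(d : ℤ) - 1) = -((d + 1 : ℕ) : ℤ) := by push_cast; ring
    simp only [e, zpow_neg, zpow_natCast]
    exact (contDiffAt_id.pow (d + 1)).inv (pow_ne_zero _ hρ)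
  exact contDiffAt_const.sub (contDiffAt_const.mul this)

/-- The derivative of `ρ ↦ ρ / accel ρ`. -/
def ratioDeriv (d : ℕ) (κ a ρ : ℝ) : ℝ :=
  (accel d κ a ρ - ρ * accelDeriv d κ a ρ) / accel d κ a ρ ^ 2

theorem hasDerivAt_ratio (hκ : 0 < κ) (ha : 0 < a) (hρ : 0 < ρ) :
    HasDerivAt (fun ρ => ρ / accel d κ a ρ) (ratioDeriv d κ a ρ) ρ := by
  refine ((hasDerivAt_id ρ).div (hasDerivAt_accel hρ.ne') (accel_pos hκ ha hρ).ne').congr_deriv ?_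
  simp [ratioDeriv]

theorem ratioDeriv_pos (hκ : 0 < κ) (ha : 0 < a) (hρ : 0 < ρ) : 0 < ratioDeriv d κ a ρ := by
  have := accel_pos (d := d) hκ ha hρ
  rw [ratioDeriv, accel_sub_mul_accelDeriv hρ.ne']
  positivity

theorem contDiffAt_ratioDeriv (hκ : 0 < κ) (ha : 0 < a) (hρ : 0 < ρ) :
    ContDiffAt ℝ ∞ (ratioDeriv d κ a) ρ := by
  have h1 := contDiffAt_accel (d := d) (κ := κ) (a := a) hρ.ne'
  exact (h1.sub (contDiffAt_id.mul (contDiffAt_accelDeriv hρ.ne'))).div (h1.pow 2)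
    (pow_ne_zero _ (accel_pos hκ ha hρ).ne')

theorem ratio_le (hκ : 0 < κ) (ha : 0 < a) (hρ : 0 < ρ) : ρ / accel d κ a ρ ≤ 1 / κ := by
  rw [div_le_div_iff₀ (accel_pos hκ ha hρ) hκ, accel]
  have : 0 < a * ρ ^ (-(d : ℤ)) := by positivity
  linarith

/-- Away from ρ = 0 the derivative is bounded. With ρ₀ = r(0) this gives the ODE uniqueness behind
the evenness of r. -/
theorem exists_lipschitzOnWith_accel {ρ₀ : ℝ} (hκ : 0 < κ) (ha : 0 < a) (hρ₀ : 0 < ρ₀) :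
    ∃ K, LipschitzOnWith K (accel d κ a) (Ici ρ₀) := by
  have hK : 0 ≤ κ + a * d * ρ₀ ^ (-(d : ℤ) - 1) := by positivity
  refine ⟨Real.toNNReal (κ + a * d * ρ₀ ^ (-(d : ℤ) - 1)), (convex_Ici ρ₀).lipschitzOnWith_of_nnnorm_hasDerivWithin_le
    (fun ρ hρ => (hasDerivAt_accel (hρ₀.trans_le hρ).ne').hasDerivWithinAt) fun ρ hρ => ?_⟩
  rw [← NNReal.coe_le_coe, coe_nnnorm, Real.norm_eq_abs, Real.coe_toNNReal _ hK, accelDeriv]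
  have hρ' : 0 < ρ := hρ₀.trans_le hρ
  have h1 : ρ ^ (-(d : ℤ) - 1) ≤ ρ₀ ^ (-(d : ℤ) - 1) := by
    have e : (-(d : ℤ) - 1) = -((d + 1 : ℕ) : ℤ) := by push_cast; ring
    rw [e, zpow_neg, zpow_neg, zpow_natCast, zpow_natCast]
    exact inv_anti₀ (by positivity) (pow_le_pow_left₀ hρ₀.le hρ _)
  have h2 : 0 ≤ ρ ^ (-(d : ℤ) - 1) := by positivity
  have h3 : a * d * ρ ^ (-(d : ℤ) - 1) ≤ a * d * ρ₀ ^ (-(d : ℤ) - 1) := by gcongr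
  have h4 : 0 ≤ a * d * ρ ^ (-(d : ℤ) - 1) := by positivity
  rw [abs_le]
  constructor <;> linarith

end accel

/-! ### The area radius: second-order equation, monotonicity, evenness. -/

namespace IsProfile

variable {d : ℕ} {R a : ℝ} {r : ℝ → ℝ}

/-- The number `-R / (n (n - 1))` for `n = d + 1`. -/
def kap (d : ℕ) (R : ℝ) : ℝ := -R / ((d + 1) * d)

theorem kap_pos (hd : 2 ≤ d) (hR : R < 0) : 0 < kap d R := by
  have : (0 : ℝ) < d := by positivity
  exact div_pos (by linarith) (by positivity)

theorem potential_eq {ρ : ℝ} (hρ : ρ ≠ 0) :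
    potential (d + 1) R a ρ = 1 + kap d R * ρ ^ 2 - 2 * a / (d - 1) * (ρ * ρ ^ (-(d : ℤ))) := by
  have e : (2 - ((d + 1 : ℕ) : ℤ)) = -(d : ℤ) + 1 := by push_cast; ring
  rw [potential, e, zpow_add_one₀ hρ, kap]
  push_cast
  rw [show (d : ℝ) + 1 - 1 = d by ring, show (d : ℝ) + 1 - 2 = d - 1 by ring]
  ring

theorem hasDerivAt_potential (hd : 2 ≤ d) {ρ : ℝ} (hρ : ρ ≠ 0) :
    HasDerivAt (potential (d + 1) R a) (2 * accel d (kap d R) a ρ) ρ := by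
  have hd' : (d : ℝ) - 1 ≠ 0 := by
    have : (2 : ℝ) ≤ d := by exact_mod_cast hd
    linarith
  have h := (((hasDerivAt_id ρ).pow 2).const_mul (kap d R)).const_add 1 |>.sub
    (((hasDerivAt_id ρ).mul (hasDerivAt_zpow (-(d : ℤ)) ρ (.inl hρ))).const_mul (2 * a / (d - 1)))
  have e : potential (d + 1) R a =ᶠ[𝓝 ρ] fun ρ =>
      1 + kap d R * ρ ^ 2 - 2 * a / (d - 1) * (ρ * ρ ^ (-(d : ℤ))) := by
    filter_upwards [isOpen_ne.mem_nhds hρ] with ρ hρ using potential_eq hρ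
  refine (HasDerivAt.congr_of_eventuallyEq h e).congr_deriv ?_
  simp only [accel, id]
  rw [zpow_sub_one₀ hρ]
  push_cast
  field_simp
  ring

section

variable (hr : IsProfile (d + 1) R a r) (hd : 2 ≤ d)
include hr

theorem differentiable : Differentiable ℝ r := hr.smooth.differentiable (by simp)

theorem hasDerivAt (s : ℝ) : HasDerivAt r (deriv r s) s := (hr.differentiable s).hasDerivAt

theorem contDiff_deriv : ContDiff ℝ ∞ (deriv r) := ((contDiff_infty_iff_deriv (𝕜 := ℝ)).1 hr.smooth).2

theorem deriv_zero : deriv r 0 = 0 := by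
  have hc : Continuous (deriv r) := hr.contDiff_deriv.continuous
  refine le_antisymm ?_ ?_
  · have : closure (Iio (0 : ℝ)) ⊆ {s | deriv r s ≤ 0} :=
      closure_minimal (fun s hs => (hr.deriv_neg s hs).le) (isClosed_le hc continuous_const)
    exact this (by simp)
  · have : closure (Ioi (0 : ℝ)) ⊆ {s | 0 ≤ deriv r s} :=
      closure_minimal (fun s hs => (hr.deriv_pos s hs).le) (isClosed_le continuous_const hc)
    exact this (by simp)

-- Differentiating (r')² = potential(r) and cancelling 2r' works off the horizon; continuity of both
-- sides extends the identity to s = 0.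
include hd in
theorem hasDerivAt_deriv (s : ℝ) :
    HasDerivAt (deriv r) (accel d (kap d R) a (r s)) s := by
  have hd2 : ContDiff ℝ ∞ (deriv (deriv r)) :=
    ((contDiff_infty_iff_deriv (𝕜 := ℝ)).1 hr.contDiff_deriv).2
  have h2 : ∀ s, HasDerivAt (deriv r) (deriv (deriv r) s) s := fun s =>
    (hr.contDiff_deriv.differentiable (by simp) s).hasDerivAt
  have hc : Continuous fun s => accel d (kap d R) a (r s) :=
    continuous_iff_continuousAt.2 fun s =>
      ((hasDerivAt_accel (hr.pos s).ne').continuousAt).comp hr.smooth.continuous.continuousAt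
  have key : deriv (deriv r) = fun s => accel d (kap d R) a (r s) := by
    refine hd2.continuous.ext_on (dense_compl_singleton (0 : ℝ)) hc fun s hs => ?_
    have h3 : HasDerivAt (fun s => deriv r s ^ 2) _ s := (h2 s).pow 2
    rw [funext hr.deriv_sq] at h3
    have h4 := h3.unique ((hasDerivAt_potential hd (hr.pos s).ne').comp s (hr.hasDerivAt s))
    have hne : deriv r s ≠ 0 := by
      rcases lt_or_gt_of_ne (show s ≠ 0 from hs) with h | h
      · exact (hr.deriv_neg s h).ne
      · exact (hr.deriv_pos s h).ne'
    have h5 : deriv r s * (deriv (deriv r) s - accel d (kap d R) a (r s)) = 0 := by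
      push_cast at h4
      linear_combination h4 / 2
    exact sub_eq_zero.1 ((mul_eq_zero.1 h5).resolve_left hne)
  exact (h2 s).congr_deriv (congrFun key s)

theorem strictMonoOn : StrictMonoOn r (Ici 0) :=
  strictMonoOn_of_deriv_pos (convex_Ici 0) hr.smooth.continuous.continuousOn fun s hs =>
    hr.deriv_pos s (by simpa using hs)

theorem strictAntiOn : StrictAntiOn r (Iic 0) :=
  strictAntiOn_of_deriv_neg (convex_Iic 0) hr.smooth.continuous.continuousOn fun s hs =>
    hr.deriv_neg s (by simpa using hs)

theorem zero_le_apply (s : ℝ) : r 0 ≤ r s := by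
  rcases le_total 0 s with h | h
  · exact hr.strictMonoOn.monotoneOn self_mem_Ici h h
  · exact hr.strictAntiOn.antitoneOn h self_mem_Iic h

include hd in
/-- The reflection with respect to the horizon is an isometry. -/
theorem even (hR : R < 0) (ha : 0 < a) (s : ℝ) : r (-s) = r s := by
  obtain ⟨K, hK⟩ := exists_lipschitzOnWith_accel (d := d) (kap_pos hd hR) ha (hr.pos 0)
  have hL : LipschitzOnWith (max 1 K) (fun y : ℝ × ℝ => (y.2, accel d (kap d R) a y.1))
      {y | r 0 ≤ y.1} := by
    have h1 : LipschitzOnWith 1 (Prod.snd : ℝ × ℝ → ℝ) {y | r 0 ≤ y.1} :=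
      LipschitzWith.prod_snd.lipschitzOnWith
    have h2 : LipschitzOnWith (K * 1) (fun y : ℝ × ℝ => accel d (kap d R) a y.1) {y | r 0 ≤ y.1} :=
      hK.comp LipschitzWith.prod_fst.lipschitzOnWith fun y hy => hy
    rw [mul_one] at h2
    exact h1.prodMk h2
  -- Both r(s) and r(-s) solve the first-order system for (r, r') and stay in {r ≥ r(0)}; their data
  -- at 0 agree because r'(0) = 0.
  have h := ODE_solution_unique_univ (v := fun _ y => (y.2, accel d (kap d R) a y.1))
    (s := fun _ => {y : ℝ × ℝ | r 0 ≤ y.1}) (K := max 1 K) (t₀ := 0)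
    (f := fun s => (r (-s), -deriv r (-s))) (g := fun s => (r s, deriv r s))
    (fun _ => hL) (fun t => ⟨?_, hr.zero_le_apply _⟩)
    (fun t => ⟨(hr.hasDerivAt t).prodMk (hr.hasDerivAt_deriv hd t), hr.zero_le_apply _⟩)
    (by simp [hr.deriv_zero])
  · exact congrArg Prod.fst (congrFun h s)
  · have h1 := (hr.hasDerivAt (-t)).comp t (hasDerivAt_neg t)
    have h2 := ((hr.hasDerivAt_deriv hd (-t)).comp t (hasDerivAt_neg t)).neg
    refine (HasDerivAt.prodMk h1 h2).congr_deriv ?_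
    simp

end

end IsProfile

end AdS

/-- If `ψ` decreases strictly from `+∞` on `(0, ∞)`, is bounded below and takes a negative value,
then far enough out the values of `ψ` come in pairs of opposite sign. -/
theorem exists_opposite_values {ψ : ℝ → ℝ} (hc : ContinuousOn ψ (Ioi 0))
    (ha : StrictAntiOn ψ (Ioi 0)) (ht : ∀ c, ∃ s, 0 < s ∧ c < ψ s)
    (hb : ∃ m, ∀ s, 0 < s → m ≤ ψ s) (hneg : ∃ s, 0 < s ∧ ψ s < 0) :
    ∃ ζ, 0 < ζ ∧ (∀ s, ζ < s → ∃ t, ζ < t ∧ ψ t = -ψ s) ∧ ∃ θ, ζ < θ ∧ ψ θ = 0 := by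
  have hB : BddBelow (ψ '' Ioi 0) := by
    obtain ⟨m, hm⟩ := hb
    exact ⟨m, by rintro _ ⟨s, hs, rfl⟩; exact hm s hs⟩
  set L := sInf (ψ '' Ioi 0) with hL
  -- Comparison with s + 1 makes the bound strict: the infimum is not attained.
  have hle : ∀ s, 0 < s → L < ψ s := fun s hs =>
    (csInf_le hB ⟨s + 1, by simp only [mem_Ioi]; linarith, rfl⟩).trans_lt
      (ha hs (by simp only [mem_Ioi]; linarith) (by linarith))
  have hL0 : L < 0 := by
    obtain ⟨s, hs, h⟩ := hneg
    exact (hle s hs).trans h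
  have hatt : ∀ c, L < c → ∃ s, 0 < s ∧ ψ s = c := by
    intro c hLc
    obtain ⟨_, ⟨s₁, hs₁, rfl⟩, h₁⟩ := exists_lt_of_csInf_lt
      (⟨ψ 1, 1, mem_Ioi.2 one_pos, rfl⟩ : (ψ '' Ioi 0).Nonempty) hLc
    obtain ⟨s₀, hs₀, h₀⟩ := ht c
    have h := (ordConnected_Ioi (a := (0 : ℝ))).isPreconnected.intermediate_value hs₁
      (show s₀ ∈ Ioi 0 from hs₀) hc
    obtain ⟨s, hs, rfl⟩ := h ⟨h₁.le, h₀.le⟩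
    exact ⟨s, hs, rfl⟩
  -- Beyond this ζ the values of ψ lie in (L, -L), an interval invariant under negation.
  obtain ⟨ζ, hζ, hψζ⟩ := hatt (-L) (by linarith)
  refine ⟨ζ, hζ, fun s hs => ?_, ?_⟩
  · have h1 : ψ s < -L := hψζ ▸ ha hζ (hζ.trans hs) hs
    have h2 := hle s (hζ.trans hs)
    obtain ⟨t, ht, htψ⟩ := hatt (-ψ s) (by linarith)
    exact ⟨t, (ha.lt_iff_gt ht hζ).1 (by rw [hψζ, htψ]; linarith), htψ⟩
  · obtain ⟨θ, hθ, hψθ⟩ := hatt 0 hL0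
    exact ⟨θ, (ha.lt_iff_gt hθ hζ).1 (by rw [hψζ, hψθ]; linarith), hψθ⟩

/-! ### Radial solutions and their zeros. -/

namespace AdS

open IsProfile

/-- The integral `∫₀ˢ (ρ / accel ρ)'(r(t)) dt`. -/
def ratioIntegral (d : ℕ) (κ a : ℝ) (r : ℝ → ℝ) (s : ℝ) : ℝ :=
  ∫ t in (0 : ℝ)..s, ratioDeriv d κ a (r t)

/-- The radial solutions of the critical equation. -/
def solution (d : ℕ) (κ a : ℝ) (r : ℝ → ℝ) (c s : ℝ) : ℝ :=
  r s / accel d κ a (r s) / d + deriv r s * (c - ratioIntegral d κ a r s / d)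

/-- The solution that is even in `s`, divided by `r'`. -/
def solutionRatio (d : ℕ) (κ a : ℝ) (r : ℝ → ℝ) (s : ℝ) : ℝ :=
  (r s / accel d κ a (r s) / deriv r s - ratioIntegral d κ a r s) / d

namespace IsProfile

variable {d : ℕ} {R a : ℝ} {r : ℝ → ℝ} (hr : IsProfile (d + 1) R a r) (hd : 2 ≤ d) (hR : R < 0)
  (ha : 0 < a)

include hr hd hR ha

theorem contDiff_ratioDeriv : ContDiff ℝ ∞ fun s => ratioDeriv d (kap d R) a (r s) :=
  contDiff_iff_contDiffAt.2 fun s =>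
    (contDiffAt_ratioDeriv (kap_pos hd hR) ha (hr.pos s)).comp s hr.smooth.contDiffAt

theorem hasDerivAt_ratioIntegral (s : ℝ) :
    HasDerivAt (ratioIntegral d (kap d R) a r) (ratioDeriv d (kap d R) a (r s)) s :=
  ((contDiff_ratioDeriv hr hd hR ha).continuous.integral_hasStrictDerivAt 0 s).hasDerivAt

theorem contDiff_ratioIntegral : ContDiff ℝ ∞ (ratioIntegral d (kap d R) a r) := by
  rw [contDiff_infty_iff_deriv]
  refine ⟨fun s => (hasDerivAt_ratioIntegral hr hd hR ha s).differentiableAt, ?_⟩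
  rw [funext fun s => (hasDerivAt_ratioIntegral hr hd hR ha s).deriv]
  exact contDiff_ratioDeriv hr hd hR ha

theorem ratioIntegral_neg (s : ℝ) :
    ratioIntegral d (kap d R) a r (-s) = -ratioIntegral d (kap d R) a r s := by
  have h := intervalIntegral.integral_comp_neg (a := 0) (b := s)
    fun t => ratioDeriv d (kap d R) a (r t)
  simp only [hr.even hd hR ha, neg_zero] at h
  rw [ratioIntegral, ratioIntegral, h, intervalIntegral.integral_symm]

theorem hasDerivAt_ratio_comp (s : ℝ) :
    HasDerivAt (fun s => r s / accel d (kap d R) a (r s))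
      (ratioDeriv d (kap d R) a (r s) * deriv r s) s :=
  (hasDerivAt_ratio (kap_pos hd hR) ha (hr.pos s)).comp s (hr.hasDerivAt s)

/-- The derivative of (r/r'')/d cancels against r' times the derivative of the integral; only r''
times the bracket survives. -/
theorem hasDerivAt_solution (c s : ℝ) :
    HasDerivAt (solution d (kap d R) a r c)
      (accel d (kap d R) a (r s) * (c - ratioIntegral d (kap d R) a r s / d)) s := by
  refine (((hasDerivAt_ratio_comp hr hd hR ha s).div_const d).add ((hr.hasDerivAt_deriv hd s).mul
    (((hasDerivAt_ratioIntegral hr hd hR ha s).div_const d).const_sub c))).congr_deriv ?_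
  ring

theorem hasDerivAt_deriv_solution (c s : ℝ) :
    HasDerivAt (deriv (solution d (kap d R) a r c))
      (accelDeriv d (kap d R) a (r s) * deriv r s * (c - ratioIntegral d (kap d R) a r s / d) -
        accel d (kap d R) a (r s) * ratioDeriv d (kap d R) a (r s) / d) s := by
  rw [funext fun s => (hasDerivAt_solution hr hd hR ha c s).deriv]
  refine (((hasDerivAt_accel (hr.pos s).ne').comp s (hr.hasDerivAt s)).mul
    (((hasDerivAt_ratioIntegral hr hd hR ha s).div_const d).const_sub c)).congr_deriv ?_
  simp only [Function.comp_apply]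
  ring

theorem contDiff_solution (c : ℝ) : ContDiff ℝ ∞ (solution d (kap d R) a r c) := by
  rw [contDiff_infty_iff_deriv]
  refine ⟨fun s => (hasDerivAt_solution hr hd hR ha c s).differentiableAt, ?_⟩
  rw [funext fun s => (hasDerivAt_solution hr hd hR ha c s).deriv]
  have h1 : ContDiff ℝ ∞ fun s => accel d (kap d R) a (r s) := contDiff_iff_contDiffAt.2 fun s =>
    (contDiffAt_accel (hr.pos s).ne').comp s hr.smooth.contDiffAt
  exact h1.mul (contDiff_const.sub ((contDiff_ratioIntegral hr hd hR ha).div_const _))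

theorem solution_first (c s : ℝ) :
    d * (solution d (kap d R) a r c s * accel d (kap d R) a (r s) -
      deriv (solution d (kap d R) a r c) s * deriv r s) = r s := by
  have hd0 : (d : ℝ) ≠ 0 := by positivity
  have h1 := (accel_pos (d := d) (kap_pos hd hR) ha (hr.pos s)).ne'
  rw [(hasDerivAt_solution hr hd hR ha c s).deriv, solution]
  field_simp
  ring

theorem solution_second (c s : ℝ) :
    -(r s ^ 2 * (accelDeriv d (kap d R) a (r s) * deriv r s *
        (c - ratioIntegral d (kap d R) a r s / d) -
          accel d (kap d R) a (r s) * ratioDeriv d (kap d R) a (r s) / d))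
      - (d - 1) * r s * deriv r s * deriv (solution d (kap d R) a r c) s
      - solution d (kap d R) a r c s *
        ((d - 1) * (1 - deriv r s ^ 2) - r s * accel d (kap d R) a (r s)) = r s ^ 2 := by
  have hd0 : (d : ℝ) ≠ 0 := by positivity
  have hd1 : (d : ℝ) - 1 ≠ 0 := by
    have : (2 : ℝ) ≤ d := by exact_mod_cast hd
    linarith
  have h1 := (accel_pos (d := d) (kap_pos hd hR) ha (hr.pos s)).ne'
  have h0 := (hr.pos s).ne'
  -- Multiplied by -r', this is the homogeneous tangential equation for F = r'. It is where the
  -- explicit potential enters.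
  have hK : r s ^ 2 * accelDeriv d (kap d R) a (r s) + (d - 2) * r s * accel d (kap d R) a (r s) +
      (d - 1) * (1 - deriv r s ^ 2) = 0 := by
    rw [hr.deriv_sq, potential_eq h0, accelDeriv, accel, zpow_sub_one₀ h0]
    field_simp
    ring
  -- That is, F'' = accel'(r) F - 1/d; with the radial equation and `hK` this gives the tangential
  -- equation.
  have hF : solution d (kap d R) a r c s * accelDeriv d (kap d R) a (r s) - 1 / d =
      accelDeriv d (kap d R) a (r s) * deriv r s * (c - ratioIntegral d (kap d R) a r s / d) -
          accel d (kap d R) a (r s) * ratioDeriv d (kap d R) a (r s) / d := by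
    rw [solution, ratioDeriv]
    field_simp
    ring
  have hE := solution_first hr hd hR ha c s
  have hdd : (d : ℝ) * (1 / d) = 1 := by field_simp
  rw [← hF]
  linear_combination (-solution d (kap d R) a r c s) * hK + (1 / d) * (d - 1) * r s * hE +
    (r s * r s - (d - 1) * r s * (solution d (kap d R) a r c s * accel d (kap d R) a (r s) -
      deriv (solution d (kap d R) a r c) s * deriv r s)) * hdd

theorem deriv_neg_eq (s : ℝ) : deriv r (-s) = -deriv r s := by
  have h := (hr.hasDerivAt (-s)).comp s (hasDerivAt_neg s)
  have e : r ∘ Neg.neg = r := funext fun s => hr.even hd hR ha s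
  rw [e] at h
  have := h.deriv
  linarith

theorem solution_eq {c s : ℝ} (hs : 0 < s) :
    solution d (kap d R) a r c s = deriv r s * (solutionRatio d (kap d R) a r s + c) := by
  have h := (hr.deriv_pos s hs).ne'
  have h1 := (accel_pos (d := d) (kap_pos hd hR) ha (hr.pos s)).ne'
  have hd0 : (d : ℝ) ≠ 0 := by positivity
  rw [solution, solutionRatio]
  field_simp
  ring

theorem solution_neg_eq {c s : ℝ} :
    solution d (kap d R) a r c (-s) = solution d (kap d R) a r (-c) s := by
  rw [solution, solution, hr.even hd hR ha, deriv_neg_eq hr hd hR ha,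
    ratioIntegral_neg hr hd hR ha]
  ring

/-- This is the radial equation divided by r'²; the contributions of the derivative of r/r'' cancel.
-/
theorem hasDerivAt_solutionRatio {s : ℝ} (hs : 0 < s) :
    HasDerivAt (solutionRatio d (kap d R) a r) (-(r s / (d * deriv r s ^ 2))) s := by
  have h := (hr.deriv_pos s hs).ne'
  have h1 := (accel_pos (d := d) (kap_pos hd hR) ha (hr.pos s)).ne'
  have hd0 : (d : ℝ) ≠ 0 := by positivity
  refine ((((hasDerivAt_ratio_comp hr hd hR ha s).div (hr.hasDerivAt_deriv hd s) h).sub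
    (hasDerivAt_ratioIntegral hr hd hR ha s)).div_const d).congr_deriv ?_
  field_simp
  ring

theorem strictAntiOn_solutionRatio : StrictAntiOn (solutionRatio d (kap d R) a r) (Ioi 0) := by
  refine strictAntiOn_of_deriv_neg (convex_Ioi 0) (fun s hs =>
    (hasDerivAt_solutionRatio hr hd hR ha hs).continuousAt.continuousWithinAt) fun s hs => ?_
  rw [interior_Ioi] at hs
  rw [(hasDerivAt_solutionRatio hr hd hR ha hs).deriv]
  have h := hr.deriv_pos s hs
  have h0 := hr.pos s
  have hd0 : (0 : ℝ) < d := by positivity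
  have : 0 < r s / (d * deriv r s ^ 2) := by positivity
  linarith

/-- As s decreases to 0, r' tends to 0 from above while r/r'' has a positive limit and the integral
stays bounded. -/
theorem solutionRatio_unbounded (c : ℝ) : ∃ s, 0 < s ∧ c < solutionRatio d (kap d R) a r s := by
  have hd0 : (0 : ℝ) < d := by positivity
  have h1 : Filter.Tendsto (deriv r) (𝓝[>] 0) (𝓝[>] 0) := by
    refine tendsto_nhdsWithin_iff.2 ⟨?_, ?_⟩
    · have := hr.contDiff_deriv.continuous.tendsto 0
      rw [hr.deriv_zero] at this
      exact this.mono_left nhdsWithin_le_nhds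
    · filter_upwards [self_mem_nhdsWithin] with s hs using hr.deriv_pos s hs
  have h2 : Filter.Tendsto (fun s => (deriv r s)⁻¹) (𝓝[>] 0) Filter.atTop :=
    tendsto_inv_nhdsGT_zero.comp h1
  have h3 : Filter.Tendsto (fun s => r s / accel d (kap d R) a (r s)) (𝓝[>] 0)
      (𝓝 (r 0 / accel d (kap d R) a (r 0))) :=
    (hasDerivAt_ratio_comp hr hd hR ha 0).continuousAt.tendsto.mono_left nhdsWithin_le_nhds
  have h4 : Filter.Tendsto (fun s => -ratioIntegral d (kap d R) a r s) (𝓝[>] 0)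
      (𝓝 (-ratioIntegral d (kap d R) a r 0)) :=
    (hasDerivAt_ratioIntegral hr hd hR ha 0).continuousAt.neg.tendsto.mono_left nhdsWithin_le_nhds
  have h5 := ((h3.pos_mul_atTop (div_pos (hr.pos 0)
    (accel_pos (kap_pos hd hR) ha (hr.pos 0))) h2).atTop_add h4).atTop_div_const hd0
  obtain ⟨s, hs, hs'⟩ := ((h5.eventually_gt_atTop c).and self_mem_nhdsWithin).exists
  refine ⟨s, hs', ?_⟩
  rw [solutionRatio, div_eq_mul_inv _ (deriv r s), sub_eq_add_neg]
  exact hs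

theorem ratioIntegral_mono : Monotone (ratioIntegral d (kap d R) a r) :=
  monotone_of_hasDerivAt_nonneg (hasDerivAt_ratioIntegral hr hd hR ha) fun s =>
    (ratioDeriv_pos (kap_pos hd hR) ha (hr.pos s)).le

theorem ratioIntegral_one_pos : 0 < ratioIntegral d (kap d R) a r 1 :=
  intervalIntegral.intervalIntegral_pos_of_pos
    ((contDiff_ratioDeriv hr hd hR ha).continuous.intervalIntegrable _ _)
    (fun s => ratioDeriv_pos (kap_pos hd hR) ha (hr.pos s)) one_pos

theorem monotone_deriv : Monotone (deriv r) :=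
  monotone_of_hasDerivAt_nonneg (hr.hasDerivAt_deriv hd) fun s =>
    (accel_pos (kap_pos hd hR) ha (hr.pos s)).le

/-- Integrate r'' ≥ κr ≥ κr(0) from the horizon, where r' = 0. -/
theorem le_deriv {s : ℝ} (hs : 0 ≤ s) : kap d R * r 0 * s ≤ deriv r s := by
  have h : ∀ s, HasDerivAt (fun s => deriv r s - kap d R * r 0 * s)
      (accel d (kap d R) a (r s) - kap d R * r 0) s := fun s => by
    refine ((hr.hasDerivAt_deriv hd s).sub
      ((hasDerivAt_id s).const_mul (kap d R * r 0))).congr_deriv ?_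
    simp
  have hm := monotone_of_hasDerivAt_nonneg h fun s => by
    have h1 := mul_le_mul_of_nonneg_left (hr.zero_le_apply s) (kap_pos hd hR).le
    have h2 : 0 < a * r s ^ (-(d : ℤ)) := mul_pos ha (zpow_pos (hr.pos s) _)
    simp only [Pi.zero_apply, accel]
    linarith
  have := hm hs
  simp only [hr.deriv_zero] at this
  linarith

/-- For s ≥ 1 the integral is at least its value J > 0 at 1, whereas (r/r'')/r' ≤ 1/(κ · κr(0)s)
tends to 0. -/
theorem solutionRatio_neg : ∃ s, 0 < s ∧ solutionRatio d (kap d R) a r s < 0 := by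
  have hd0 : (0 : ℝ) < d := by positivity
  have hκ := kap_pos hd hR
  have hJ := ratioIntegral_one_pos hr hd hR ha
  set J := ratioIntegral d (kap d R) a r 1 with hJd
  have h0 := hr.pos 0
  -- Chosen so that κr(0)qJ = 1/κ; then at s = 1 + q the quotient is strictly below J.
  set q := 1 / (kap d R * (kap d R * r 0) * J) with hq
  have hq0 : 0 < q := by positivity
  refine ⟨1 + q, by positivity, div_neg_of_neg_of_pos ?_ hd0⟩
  have h1 : J ≤ ratioIntegral d (kap d R) a r (1 + q) :=
    ratioIntegral_mono hr hd hR ha (by linarith)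
  have h2 := ratio_le (d := d) hκ ha (hr.pos (1 + q))
  have h3 := le_deriv hr hd hR ha (s := 1 + q) (by positivity)
  have h4 : kap d R * r 0 * q < kap d R * r 0 * (1 + q) := by
    have : 0 < kap d R * r 0 := by positivity
    nlinarith
  have h5 : kap d R * r 0 * q * J = 1 / kap d R := by
    rw [hq]
    field_simp
  have h6 := hr.deriv_pos (1 + q) (by positivity)
  have h7 : r (1 + q) / accel d (kap d R) a (r (1 + q)) / deriv r (1 + q) < J := by
    rw [div_lt_iff₀ h6]
    nlinarith
  linarith

/-- The integral is bounded: beyond 1, r' ≥ r'(1), so its integrand is at most (r/r'')'/r'(1), and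
r/r'' ≤ 1/κ. On (0, 1] monotonicity suffices. -/
theorem solutionRatio_bddBelow : ∃ m, ∀ s, 0 < s → m ≤ solutionRatio d (kap d R) a r s := by
  have hd0 : (0 : ℝ) < d := by positivity
  have hκ := kap_pos hd hR
  have hp := hr.deriv_pos 1 one_pos
  set q : ℝ := ratioIntegral d (kap d R) a r 1 + 1 / kap d R / deriv r 1 with hq
  have h1 : ∀ s, 1 ≤ s → -q / d ≤ solutionRatio d (kap d R) a r s := by
    intro s hs
    have hm : MonotoneOn (fun s => r s / accel d (kap d R) a (r s) / deriv r 1 -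
        ratioIntegral d (kap d R) a r s) (Ici 1) := by
      have hD := fun s => ((hasDerivAt_ratio_comp hr hd hR ha s).div_const (deriv r 1)).sub
        (hasDerivAt_ratioIntegral hr hd hR ha s)
      refine monotoneOn_of_deriv_nonneg (convex_Ici 1)
        (fun s _ => (hD s).continuousAt.continuousWithinAt)
        (fun s _ => (hD s).differentiableAt.differentiableWithinAt) fun s hs => ?_
      rw [interior_Ici] at hs
      refine (hD s).deriv.symm ▸ ?_
      have h2 : deriv r 1 ≤ deriv r s := monotone_deriv hr hd hR ha (le_of_lt hs)
      have h3 := ratioDeriv_pos (d := d) hκ ha (hr.pos s)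
      rw [sub_nonneg, le_div_iff₀ hp]
      gcongr
    have h4 := hm self_mem_Ici hs hs
    simp only at h4
    have h5 : r s / accel d (kap d R) a (r s) / deriv r 1 ≤ 1 / kap d R / deriv r 1 :=
      div_le_div_of_nonneg_right (ratio_le hκ ha (hr.pos s)) hp.le
    have h6 : 0 < r 1 / accel d (kap d R) a (r 1) / deriv r 1 :=
      div_pos (div_pos (hr.pos 1) (accel_pos hκ ha (hr.pos 1))) hp
    have h7 : 0 < r s / accel d (kap d R) a (r s) / deriv r s :=
      div_pos (div_pos (hr.pos s) (accel_pos hκ ha (hr.pos s))) (hr.deriv_pos s (by linarith))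
    rw [solutionRatio]
    gcongr
    linarith
  refine ⟨-q / d, fun s hs => ?_⟩
  rcases le_total 1 s with h | h
  · exact h1 s h
  · exact (h1 1 le_rfl).trans
      ((strictAntiOn_solutionRatio hr hd hR ha).antitoneOn hs (mem_Ioi.2 one_pos) h)

/-- Beyond some `ζ`, the zeros of the solutions on the two sides of the horizon are paired. -/
theorem exists_solution_zeros :
    ∃ ζ, 0 < ζ ∧
      (∀ s, ζ < s → ∃ t, ζ < t ∧ ∃ c, solution d (kap d R) a r c s = 0 ∧
        solution d (kap d R) a r c (-t) = 0) ∧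
      ∃ θ, ζ < θ ∧ solution d (kap d R) a r 0 θ = 0 := by
  obtain ⟨ζ, hζ, h1, θ, hθ, h2⟩ := exists_opposite_values
    (fun s hs => (hasDerivAt_solutionRatio hr hd hR ha hs).continuousAt.continuousWithinAt)
    (strictAntiOn_solutionRatio hr hd hR ha) (solutionRatio_unbounded hr hd hR ha)
    (solutionRatio_bddBelow hr hd hR ha) (solutionRatio_neg hr hd hR ha)
  refine ⟨ζ, hζ, fun s hs => ?_, θ, hθ, ?_⟩
  · obtain ⟨t, ht, hts⟩ := h1 s hs
    refine ⟨t, ht, -solutionRatio d (kap d R) a r s, ?_, ?_⟩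
    · rw [solution_eq hr hd hR ha (hζ.trans hs)]
      ring
    · rw [solution_neg_eq hr hd hR ha, solution_eq hr hd hR ha (hζ.trans ht), hts]
      ring
  · rw [solution_eq hr hd hR ha (hζ.trans hθ), h2]
    ring

end IsProfile

end AdS

/-! ### Critical domains in the manifold and in its quotient. -/

namespace AdS

open IsProfile RiemMfd

theorem isCompact_region (d : ℕ) (s t : ℝ) : IsCompact (region d s t) := by
  have : region d s t = Icc s t ×ˢ univ := by
    ext p
    simp [region]
  rw [this]
  exact isCompact_Icc.prod isCompact_univ

section

variable {d : ℕ} {R a : ℝ} {r : ℝ → ℝ} (hr : IsProfile (d + 1) R a r) (hd : 2 ≤ d) (hR : R < 0)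
  (ha : 0 < a)

include hr hd hR ha

theorem criticalEquationAt_of_coord_eq {M : Type*} [TopologicalSpace M]
    [ChartedSpace (ModelProd ℝ (EuclideanSpace ℝ (Fin d))) M]
    {g : ∀ q : M, TangentSpace (model d) q →L[ℝ] TangentSpace (model d) q →L[ℝ] ℝ}
    {f : M → ℝ} {p : M} {c s : ℝ} (hg : coordMetric (model d) g p = WarpedCoord.warped r)
    (hf : f ∘ (extChartAt (model d) p).symm = fun y => solution d (kap d R) a r c y.1)
    (hp : extChartAt (model d) p p = (s, 0)) : CriticalEquationAt (model d) g f p := by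
  refine criticalEquationAt_of_warped (model d) hr.smooth (fun s => (hr.pos s).ne')
    (contDiff_solution hr hd hR ha c) (hr.hasDerivAt_deriv hd s)
    (hasDerivAt_deriv_solution hr hd hR ha c s) hg hf hp ?_ ?_
  · rw [finrank_euclideanSpace_fin]
    exact solution_first hr hd hR ha c s
  · rw [finrank_euclideanSpace_fin]
    exact solution_second hr hd hR ha c s

theorem criticalEquationAt_solution (c : ℝ) (p : Space d) :
    CriticalEquationAt (model d) (metric d r)
      (fun p : Space d => solution d (kap d R) a r c p.1) p :=
  criticalEquationAt_of_coord_eq hr hd hR ha (coordMetric_metric d r p) rfl (extChartAt_self d p)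

theorem contMDiff_solution (c : ℝ) :
    ContMDiff (model d) 𝓘(ℝ, ℝ) ∞ (fun p : Space d => solution d (kap d R) a r c p.1) :=
  (contDiff_solution hr hd hR ha c).contMDiff.comp contMDiff_fst

theorem isCriticalOn_region {c s t : ℝ} (hst : s ≤ t)
    (hs : solution d (kap d R) a r c s = 0) (ht : solution d (kap d R) a r c t = 0) :
    IsCriticalOn (model d) (metric d r) (region d s t) := by
  refine ⟨isCompact_region d s t, fun p => solution d (kap d R) a r c p.1,
    fun p _ => contMDiff_solution hr hd hR ha c p,
    fun p _ => criticalEquationAt_solution hr hd hR ha c p, fun p hp => ?_⟩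
  have h : p.1 ∈ frontier (Icc s t) := continuous_fst.frontier_preimage_subset _ hp
  rw [frontier_Icc hst] at h
  rcases h with h | h
  · simpa only [h] using hs
  · rw [mem_singleton_iff] at h
    simpa only [h] using ht

/-- The even solution as a function on the quotient. -/
theorem exists_quot_solution :
    ∃ f : QuotSpace d → ℝ, (∀ p, f (proj d p) = solution d (kap d R) a r 0 p.1) ∧
      (∀ q, ContMDiffAt (model d) 𝓘(ℝ, ℝ) ∞ f q) ∧
      ∀ q, CriticalEquationAt (model d) (quotMetric d r) f q := by
  have hf : ∀ p, solution d (kap d R) a r 0 (Quotient.out (proj d p)).1 =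
      solution d (kap d R) a r 0 p.1 := by
    intro p
    obtain ⟨u, hu⟩ := exists_smul_eq_of_proj_eq d
      (show proj d (Quotient.out (proj d p)) = proj d p from Quotient.out_eq _)
    rw [← hu]
    rcases Int.units_eq_one_or u with rfl | rfl
    · rw [one_smul]
    · rw [neg_one_smul_eq, solution_neg_eq hr hd hR ha, neg_zero]
  have hcont : Continuous fun q : QuotSpace d =>
      solution d (kap d R) a r 0 (Quotient.out q).1 := by
    refine isQuotientMap_quotient_mk'.continuous_iff.2 ?_
    have : Continuous fun p : Space d => solution d (kap d R) a r 0 p.1 :=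
      (contMDiff_solution hr hd hR ha 0).continuous
    exact this.congr fun p => (hf p).symm
  have hsymm : ∀ q : QuotSpace d, ∃ p, extChartAt (model d) q q = (p, 0) ∧
      (fun q : QuotSpace d => solution d (kap d R) a r 0 (Quotient.out q).1) ∘
        (extChartAt (model d) q).symm = fun y => solution d (kap d R) a r 0 y.1 := by
    intro q
    obtain ⟨p, hp, hs, hc⟩ := exists_lift d q
    refine ⟨p.1, extChartAt_quot_self d hp (hc 1 p (one_smul _ p)), ?_⟩
    rw [hs]
    exact funext fun y => hf _
  refine ⟨fun q => solution d (kap d R) a r 0 (Quotient.out q).1, hf, fun q => ?_, fun q => ?_⟩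
  · obtain ⟨s, -, h⟩ := hsymm q
    rw [contMDiffAt_iff]
    refine ⟨hcont.continuousAt, ?_⟩
    have h' : ContDiff ℝ ∞ fun y : ℝ × EuclideanSpace ℝ (Fin d) =>
        solution d (kap d R) a r 0 y.1 := (contDiff_solution hr hd hR ha 0).comp contDiff_fst
    rw [← h] at h'
    exact h'.contDiffAt.contDiffWithinAt
  · obtain ⟨s, h1, h2⟩ := hsymm q
    exact criticalEquationAt_of_coord_eq hr hd hR ha
      (coordMetric_quotMetric d (hr.even hd hR ha) q) h2 h1

/-- The projection is open and continuous, so frontiers pull back and the boundary of D lies over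
|s| = θ. The horizon becomes interior, and no boundary condition arises there. -/
theorem isCriticalOn_quot {θ : ℝ} (hθ : solution d (kap d R) a r 0 θ = 0) {D : Set (QuotSpace d)}
    (hc : IsCompact D) (hD : ∀ p, proj d p ∈ D ↔ |p.1| ≤ θ) :
    IsCriticalOn (model d) (quotMetric d r) D := by
  obtain ⟨f, hf, hf', hfc⟩ := exists_quot_solution hr hd hR ha
  refine ⟨hc, f, fun q _ => hf' q, fun q _ => hfc q, fun q hq => ?_⟩
  obtain ⟨p, rfl⟩ := proj_surjective d q
  have h1 : p ∈ frontier (proj d ⁻¹' D) := by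
    rw [← (isLocalHomeomorph_proj d).isOpenMap.preimage_frontier_eq_frontier_preimage
      (isLocalHomeomorph_proj d).continuous]
    exact hq
  have h2 : proj d ⁻¹' D = {p : Space d | |p.1| ≤ θ} := ext hD
  rw [h2] at h1
  have h3 : |p.1| = θ := frontier_le_subset_eq (continuous_fst.abs) continuous_const h1
  rw [hf]
  rcases abs_choice p.1 with h | h
  · rw [← h, h3, hθ]
  · rw [← neg_neg p.1, ← h, h3, solution_neg_eq hr hd hR ha, neg_zero, hθ]

end

theorem proj_mem_image_iff {d : ℕ} {S : Set (Space d)} (p : Space d) :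
    proj d p ∈ proj d '' S ↔ p ∈ S ∨ (-p.1, -p.2) ∈ S := by
  constructor
  · rintro ⟨q, hq, h⟩
    obtain ⟨u, rfl⟩ := exists_smul_eq_of_proj_eq d h
    rcases Int.units_eq_one_or u with rfl | rfl
    · left
      rwa [one_smul] at hq
    · right
      rwa [neg_one_smul_eq] at hq
  · rintro (h | h)
    · exact ⟨p, h, rfl⟩
    · exact ⟨_, h, by rw [← neg_one_smul_eq, proj_smul]⟩

end AdS

end

theorem mainTheorem7 (d : ℕ) (hd : 2 ≤ d) (R a : ℝ) (hR : R < 0) (ha : 0 < a) (r : ℝ → ℝ)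
    (hr : AdS.IsProfile (d + 1) R a r) :
    (∃ f : AdS.Space d → ℝ, ContMDiff (AdS.model d) 𝓘(ℝ, ℝ) ∞ f ∧
      ∀ p, RiemMfd.CriticalEquationAt (AdS.model d) (AdS.metric d r) f p) ∧
    ∃ ζ : ℝ, 0 < ζ ∧
      (∀ ζ₁, ζ < ζ₁ → ∃ ζ₂, ζ₂ < -ζ ∧
        RiemMfd.IsCriticalOn (AdS.model d) (AdS.metric d r) (AdS.region d ζ₂ ζ₁)) ∧
      (∀ ζ₂, ζ₂ < -ζ → ∃ ζ₁, ζ < ζ₁ ∧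
        RiemMfd.IsCriticalOn (AdS.model d) (AdS.metric d r) (AdS.region d ζ₂ ζ₁)) ∧
      ∃ θ : ℝ, ζ < θ ∧
        RiemMfd.IsCriticalOn (AdS.model d) (AdS.quotMetric d r)
          (AdS.proj d '' AdS.region d 0 θ) ∧
        RiemMfd.IsCriticalOn (AdS.model d) (AdS.quotMetric d r)
          (AdS.proj d '' AdS.region d (-θ) 0) := by
  refine ⟨⟨_, AdS.contMDiff_solution hr hd hR ha 0, AdS.criticalEquationAt_solution hr hd hR ha 0⟩, ?_⟩
  obtain ⟨ζ, hζ, h, θ, hθ, hθ0⟩ := AdS.IsProfile.exists_solution_zeros hr hd hR ha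
  have hpc : Continuous (AdS.proj d) := (AdS.isLocalHomeomorph_proj d).continuous
  refine ⟨ζ, hζ, fun s hs => ?_, fun s hs => ?_, θ, hθ, ?_, ?_⟩
  · obtain ⟨t, ht, c, hc, hc'⟩ := h s hs
    exact ⟨-t, by linarith, AdS.isCriticalOn_region hr hd hR ha (by linarith) hc' hc⟩
  · obtain ⟨t, ht, c, hc, hc'⟩ := h (-s) (by linarith)
    refine ⟨t, ht, AdS.isCriticalOn_region hr hd hR ha (c := -c) (by linarith) ?_ ?_⟩
    · exact (AdS.IsProfile.solution_neg_eq hr hd hR ha).symm.trans hc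
    · exact (AdS.IsProfile.solution_neg_eq hr hd hR ha).symm.trans hc'
  · refine AdS.isCriticalOn_quot hr hd hR ha hθ0 ((AdS.isCompact_region d 0 θ).image hpc) fun p => ?_
    rw [AdS.proj_mem_image_iff, abs_le]
    simp only [AdS.region, mem_ofPred_eq, mem_Icc]
    grind
  · refine AdS.isCriticalOn_quot hr hd hR ha hθ0
      ((AdS.isCompact_region d (-θ) 0).image hpc) fun p => ?_
    rw [AdS.proj_mem_image_iff, abs_le]
    simp only [AdS.region, mem_ofPred_eq, mem_Icc]
    grind
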